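/- **Model (SRT-MIC with NBUE workloads).** There are $m\ge 1$ identical cores, $n\ge 1$ users $N=\{1,\dots,n\}$ and periods $t=1,2,\dots$ of length $\delta>0$. In each period each user generates one task, available at the beginning of the period and dropped if not completed by its end; a task cannot be processed on two cores at once, and preemption and migration are free. The workload of the tasks of user $i$ (the core time needed) is distributed as a non-negative random variable $W_i$ of finite mean $\mu_i$; all workloads (over users and periods) are independent. Each $W_i$ is NBUE: $E[W_i-t\mid W_i>t]\le E[W_i]$ for all $t>0$ (with $P(W_i>t)>0$). A QoS requirement vector is a rational vector $\mathbf q\in[0,1]^n$. Let $Y_i(t)$ be the indicator that the task of user $i$ is completed in period $t$; the deficits are $X_i(t+1)=\max(X_i(t)+q_i-Y_i(t+1),\,0)$. A resource allocation policy chooses, in each period and according to $\mathbf q$ and the current deficit vector $\mathbf X(t)$, a possibly randomized and non-clairvoyant way of processing the tasks: what is processed up to a time depends only on which tasks have been completed by then, with their workloads, on the time spent on the others, and on a randomization independent of the workloads. So $(\mathbf X(t))$ is a Markov chain; the initial state $\mathbf X(0)$, which may depend on $\mathbf q$, is part of the policy. The feasibility region $F_\eta$ of a policy $\eta$ is the set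 of requirement vectors $\mathbf q$ for which $(\mathbf X(t))_{t\ge1}$ is irreducible and positive recurrent, $F=\bigcup_\eta F_\eta$ over all such policies, and the efficiency ratio of $\eta$ is $\gamma_\eta=\sup\{\gamma\in\mathbb R : \gamma F\subseteq F_\eta\}$. LDF+Greedy: for each period the users are sorted by decreasing deficit, ties being broken by an arbitrary, possibly random, rule; in this order the tasks are processed non-preemptively on the $m$ cores, first the $m$ tasks of highest priority, then, whenever a core becomes available, the waiting task of highest priority. **Theorem.** In the SRT-MIC model with NBUE workloads, for every tie-breaking rule and every choice of initial states that makes the deficit chain of LDF+Greedy irreducible (for each $\mathbf q$ for which some initial state does), the efficiency ratio of LDF+Greedy satisfies $$\gamma_{\text{LDF+Greedy}}\ \ge\ \gamma_1 = 1-\frac{\max_{i\in N}\mu_i}{\delta}.$$ -/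

import Mathlib

open MeasureTheory ProbabilityTheory Set
open scoped ENNReal

noncomputable section

/-! ### Countable-state Markov chains given by their transition probabilities -/

namespace Chain

variable {S : Type*}

/-- The transition `x → y` has positive probability. -/
def CanStep (p : S → S → ℝ≥0∞) (x y : S) : Prop := p x y ≠ 0

/-- The states that `X(1), X(2), …` can visit when `X(0) = x₀`. -/
def visited (p : S → S → ℝ≥0∞) (x₀ : S) : Set S := {x | Relation.TransGen (CanStep p) x₀ x}

/-- The chain `(X(t))_{t ≥ 1}` with `X(0) = x₀` is irreducible: any two of its states
communicate. -/
def IrreducibleFrom (p : S → S → ℝ≥0∞) (x₀ : S) : Prop :=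
  ∀ x ∈ visited p x₀, ∀ y ∈ visited p x₀, Relation.ReflTransGen (CanStep p) x y

open Classical in
/-- `firstPassage p y k x` is the probability that the chain started at `x` is at `y` at
time `k + 1` and not at any of the times `1, …, k`. -/
def firstPassage (p : S → S → ℝ≥0∞) (y : S) : ℕ → S → ℝ≥0∞
  | 0, x => p x y
  | k + 1, x => ∑' z, if z = y then 0 else p x z * firstPassage p y k z

/-- Positive recurrent state: the chain returns with probability one and the mean return time
is finite. -/
def PositiveRecurrentState (p : S → S → ℝ≥0∞) (y : S) : Prop :=
  ∑' k, firstPassage p y k y = 1 ∧ ∑' k : ℕ, ((k : ℝ≥0∞) + 1) * firstPassage p y k y < ⊤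

/-- All states of the chain `(X(t))_{t ≥ 1}` with `X(0) = x₀` are positive recurrent. -/
def PositiveRecurrentFrom (p : S → S → ℝ≥0∞) (x₀ : S) : Prop :=
  ∀ x ∈ visited p x₀, PositiveRecurrentState p x

end Chain

/-! ### Greedy list scheduling -/

namespace Greedy

variable {n : ℕ}

/-- `v k` is the workload of the task with the `k`-th highest priority. That task starts at the
first time at which fewer than `m` of the tasks of higher priority are still uncompleted, which
is the first time at which one of the `m` cores is available for it; once started it runs
without interruption until it completes. -/
def start (m : ℕ) (v : Fin n → ℝ) (k : Fin n) : ℝ :=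
  sInf {s : ℝ | 0 ≤ s ∧
    (Finset.univ.filter fun j : {j : Fin n // j < k} => s < start m v j.1 + v j.1).card < m}
termination_by k
decreasing_by all_goals first | exact j.2 | exact a.2

/-- The users whose tasks are processed at time `s`, for the workloads `w` and the priority
decision `d` (`d k` is the user with the `k`-th highest priority). -/
def proc (m : ℕ) (d : Equiv.Perm (Fin n)) (w : Fin n → ℝ) (s : ℝ) : Finset (Fin n) :=
  Finset.univ.filter fun i =>
    start m (w ∘ d) (d.symm i) ≤ s ∧ s < start m (w ∘ d) (d.symm i) + w i

end Greedy

/-! ### The model -/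

/-- The SRT-MIC model: `m` identical cores, periods of length `δ`, and for each of the `n` users
the law of the workload of its tasks, a law of finite mean on the non-negative reals. -/
structure SRTMIC (n : ℕ) where
  m : ℕ
  m_pos : 0 < m
  δ : ℝ
  δ_pos : 0 < δ
  workload : Fin n → Measure ℝ
  isProb : ∀ i, IsProbabilityMeasure (workload i)
  nonneg : ∀ i, ∀ᵐ w ∂(workload i), 0 ≤ w
  integrable : ∀ i, Integrable (fun w : ℝ => w) (workload i)

attribute [instance] SRTMIC.isProb

/-- New Better than Used in Expectation: `E[W - t | W > t] ≤ E[W]` for all `t > 0` (for which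
the conditional expectation makes sense), `ν` being the law of `W`. -/
def IsNBUE (ν : Measure ℝ) : Prop :=
  ∀ t : ℝ, 0 < t → ν (Ioi t) ≠ 0 → ∫ w, (w - t) ∂(ν[|Ioi t]) ≤ ∫ w, w ∂ν

/-- Core time spent on user `i` during `[0, s)`, if at time `r` the users in `a r` are
processed. -/
def coreTime {n : ℕ} (a : ℝ → Finset (Fin n)) (i : Fin n) (s : ℝ) : ℝ :=
  volume.real {r : ℝ | r ∈ Ico 0 s ∧ i ∈ a r}

namespace SRTMIC

variable {n : ℕ} (M : SRTMIC n)

/-- `μ i`, the mean workload of user `i`. -/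
def mean (i : Fin n) : ℝ := ∫ w, w ∂(M.workload i)

/-- The way in which a non-clairvoyant policy runs one period. With the internal randomization
`ω` (independent of the workloads) and the workloads `w`, the tasks processed at time `s` of the
period are those of the users in `proc ω w s`. At most `m` tasks are processed at a time;
preemption and migration are free. -/
structure Rule where
  Seed : Type
  [mSeed : MeasurableSpace Seed]
  seedLaw : Measure Seed
  [isProbSeed : IsProbabilityMeasure seedLaw]
  proc : Seed → (Fin n → ℝ) → ℝ → Finset (Fin n)
  card_le : ∀ ω w s, 0 ≤ w → 0 ≤ s → s < M.δ → (proc ω w s).card ≤ M.m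
  measurable : ∀ i, MeasurableSet
    {z : Seed × (Fin n → ℝ) × ℝ | i ∈ proc z.1 z.2.1 z.2.2}
  /-- The decisions up to time `s` only use what is known at that time. If `w'` agrees with `w`
  on the tasks completed by time `s`, while each other task has under both a workload that
  exceeds the time spent on it so far, then the decisions up to time `s` are the same. -/
  nonClairvoyant : ∀ ω w w' s, 0 ≤ w → 0 ≤ s → s ≤ M.δ →
    (∀ i, w' i = w i ∨
      (coreTime (proc ω w) i s < w i ∧ coreTime (proc ω w) i s < w' i)) →
    ∀ r, 0 ≤ r → r ≤ s → proc ω w' r = proc ω w r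

attribute [instance] Rule.mSeed Rule.isProbSeed

open Classical in
/-- The users whose tasks complete by the end of the period. -/
def Rule.completed {M : SRTMIC n} (R : M.Rule) (ω : R.Seed) (w : Fin n → ℝ) : Finset (Fin n) :=
  Finset.univ.filter fun i => w i ≤ coreTime (R.proc ω w) i M.δ

/-- `X(t + 1) = [X(t) + q - Y(t + 1)]⁺`, where `Y` is the indicator of `C`. -/
def deficitStep (q x : Fin n → ℝ) (C : Finset (Fin n)) : Fin n → ℝ :=
  fun i => max (x i + q i - if i ∈ C then 1 else 0) 0

/-- A resource allocation policy that makes the deficits a Markov chain: in each period it runs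
a rule chosen according to the requirement vector `q` and the current deficit vector `x`. -/
abbrev Control := (q x : Fin n → ℝ) → M.Rule

/-- Transition probabilities of the deficit vector for the requirement vector `q`. Workloads of
different users, and in different periods, are independent. -/
def trans {M : SRTMIC n} (η : M.Control) (q : Fin n → ℝ) (x y : Fin n → ℝ) : ℝ≥0∞ :=
  ((η q x).seedLaw.prod (Measure.pi M.workload))
    {z : (η q x).Seed × (Fin n → ℝ) | deficitStep q x ((η q x).completed z.1 z.2) = y}

/-- A non-clairvoyant resource allocation policy, together with the initial deficit vector
`X(0)` with which it is run when the requirement vector is `q`. -/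
structure Policy where
  control : M.Control
  init : (Fin n → ℝ) → (Fin n → ℝ)

/-- QoS requirement vectors: rational, with entries in `[0, 1]`. -/
def IsRequirement (q : Fin n → ℝ) : Prop :=
  ∀ i, 0 ≤ q i ∧ q i ≤ 1 ∧ ∃ r : ℚ, (r : ℝ) = q i

/-- The standing assumption on the initial state: it makes the deficits an irreducible chain
(whenever some initial state does). -/
def Policy.InitAdmissible {M : SRTMIC n} (η : M.Policy) : Prop :=
  ∀ q, IsRequirement q → (∃ x₀, Chain.IrreducibleFrom (trans η.control q) x₀) →
    Chain.IrreducibleFrom (trans η.control q) (η.init q)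

/-- The feasibility region of `η`: the requirement vectors for which the deficits form an
irreducible and positive recurrent chain. -/
def region {M : SRTMIC n} (η : M.Policy) : Set (Fin n → ℝ) :=
  {q | IsRequirement q ∧ Chain.IrreducibleFrom (trans η.control q) (η.init q) ∧
    Chain.PositiveRecurrentFrom (trans η.control q) (η.init q)}

/-- The system feasibility region. -/
def systemRegion : Set (Fin n → ℝ) := ⋃ η : M.Policy, region η

/-- The efficiency ratio `sup {γ | γ F ⊆ F_η}`. -/
def efficiencyRatio {M : SRTMIC n} (η : M.Policy) : EReal :=
  sSup {g : EReal | ∃ γ : ℝ, g = (γ : EReal) ∧ ∀ q ∈ M.systemRegion, γ • q ∈ region η}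

end SRTMIC

/-! ### Greedy scheduling is non-clairvoyant -/

namespace Greedy

variable {n : ℕ}

/-- A task has started by time `s` iff fewer than `m` tasks of higher priority are uncompleted
at that time. -/
theorem start_le_iff {m : ℕ} (hm : 0 < m) (v : Fin n → ℝ) (k : Fin n) {s : ℝ} (hs : 0 ≤ s) :
    start m v k ≤ s ↔
      (Finset.univ.filter fun j : {j : Fin n // j < k} =>
        s < start m v j.1 + v j.1).card < m := by
  have hbdd : BddBelow {s : ℝ | 0 ≤ s ∧
    (Finset.univ.filter fun j : {j : Fin n // j < k} => s < start m v j.1 + v j.1).card < m} :=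
    ⟨0, fun x hx => hx.1⟩
  have hne : {s : ℝ | 0 ≤ s ∧
    (Finset.univ.filter fun j : {j : Fin n // j < k} =>
      s < start m v j.1 + v j.1).card < m}.Nonempty := by
    obtain ⟨B, hB⟩ := (Set.finite_range
      (fun j : {j : Fin n // j < k} => start m v j.1 + v j.1)).bddAbove
    refine ⟨max B 0, le_max_right _ _, ?_⟩
    rw [Finset.filter_false_of_mem]
    · simpa using hm
    · intro j _
      exact not_lt.2 ((hB ⟨j, rfl⟩).trans (le_max_left _ _))
  constructor
  · intro h
    by_contra hc
    have hc : m ≤ _ := not_lt.1 hc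
    set J := Finset.univ.filter fun j : {j : Fin n // j < k} => s < start m v j.1 + v j.1 with hJ
    have hJne : J.Nonempty := Finset.card_pos.1 (hm.trans_le hc)
    obtain ⟨j₀, hj₀, hmin⟩ := J.exists_min_image (fun j => start m v j.1 + v j.1) hJne
    have h1 : start m v j₀.1 + v j₀.1 ≤ start m v k := by
      conv_rhs => rw [start]
      refine le_csInf hne ?_
      rintro t ⟨_, ht⟩
      by_contra hlt
      push Not at hlt
      refine absurd ht (not_lt.2 (hc.trans (Finset.card_le_card ?_)))
      intro j hj
      simp only [Finset.mem_filter, Finset.mem_univ, true_and]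
      exact hlt.trans_le (hmin j hj)
    have h2 : s < start m v j₀.1 + v j₀.1 := (Finset.mem_filter.1 hj₀).2
    linarith
  · intro h
    rw [start]
    exact csInf_le hbdd ⟨hs, h⟩

theorem start_nonneg (m : ℕ) (v : Fin n → ℝ) (k : Fin n) : 0 ≤ start m v k := by
  rw [start]
  exact Real.sInf_nonneg fun x hx => hx.1

theorem card_proc_le {m : ℕ} (hm : 0 < m) (d : Equiv.Perm (Fin n)) (w : Fin n → ℝ) {s : ℝ}
    (hs : 0 ≤ s) : (proc m d w s).card ≤ m := by
  by_contra hc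
  push Not at hc
  set A := (proc m d w s).image d.symm with hA
  have hAc : m < A.card := by
    rwa [hA, Finset.card_image_of_injective _ d.symm.injective]
  have hmem : ∀ k ∈ A, start m (w ∘ d) k ≤ s ∧ s < start m (w ∘ d) k + (w ∘ d) k := by
    intro k hk
    obtain ⟨i, hi, rfl⟩ := Finset.mem_image.1 hk
    simpa [proc] using hi
  have hne : A.Nonempty := Finset.card_pos.1 (by omega)
  have hk := A.max'_mem hne
  have h1 := (start_le_iff hm (w ∘ d) _ hs).1 (hmem _ hk).1
  have h2 : (A.erase (A.max' hne)).card ≤ (Finset.univ.filter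
      fun j : {j : Fin n // j < A.max' hne} =>
        s < start m (w ∘ d) j.1 + (w ∘ d) j.1).card := by
    rw [← Finset.card_map (Function.Embedding.subtype _)]
    refine Finset.card_le_card fun j hj => ?_
    have hj' := Finset.mem_erase.1 hj
    simp only [Finset.mem_map, Finset.mem_filter, Finset.mem_univ, true_and]
    exact ⟨⟨j, lt_of_le_of_ne (A.le_max' j hj'.2) hj'.1⟩, (hmem j hj'.2).2, rfl⟩
  rw [Finset.card_erase_of_mem hk] at h2
  omega

theorem measurable_start {m : ℕ} (hm : 0 < m) (k : Fin n) :
    Measurable fun v : Fin n → ℝ => start m v k := by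
  induction k using WellFoundedLT.induction with
  | ind k ih =>
    refine measurable_of_Iic fun t => ?_
    rcases lt_or_ge t 0 with ht | ht
    · convert MeasurableSet.empty using 1
      ext v
      simpa using ht.trans_le (start_nonneg m v k)
    · have hcount : Measurable fun v : Fin n → ℝ =>
          (Finset.univ.filter fun j : {j : Fin n // j < k} =>
            t < start m v j.1 + v j.1).card := by
        simp only [Finset.card_filter]
        refine Finset.measurable_sum _ fun j _ => ?_
        refine Measurable.ite ?_ measurable_const measurable_const
        exact measurableSet_lt measurable_const ((ih j.1 j.2).add (measurable_pi_apply _))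
      have : (fun v : Fin n → ℝ => start m v k) ⁻¹' Iic t = (fun v : Fin n → ℝ =>
          (Finset.univ.filter fun j : {j : Fin n // j < k} =>
            t < start m v j.1 + v j.1).card) ⁻¹' Iio m := by
        ext v
        exact start_le_iff hm v k ht
      rw [this]
      exact hcount measurableSet_Iio

theorem measurableSet_proc {m : ℕ} (hm : 0 < m) (d : Equiv.Perm (Fin n)) (i : Fin n) :
    MeasurableSet {z : (Fin n → ℝ) × ℝ | i ∈ proc m d z.1 z.2} := by
  have h1 : Measurable fun z : (Fin n → ℝ) × ℝ => start m (z.1 ∘ d) (d.symm i) := by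
    refine (measurable_start hm _).comp ?_
    exact measurable_pi_lambda _ fun j => (measurable_pi_apply _).comp measurable_fst
  have h2 : Measurable fun z : (Fin n → ℝ) × ℝ => z.1 i :=
    (measurable_pi_apply _).comp measurable_fst
  simp only [proc, Finset.mem_filter, Finset.mem_univ, true_and]
  exact (measurableSet_le h1 measurable_snd).inter (measurableSet_lt measurable_snd (h1.add h2))

/-- The time spent on a task by time `s`. -/
theorem coreTime_proc (m : ℕ) (d : Equiv.Perm (Fin n)) (w : Fin n → ℝ) (i : Fin n) (s : ℝ) :
    coreTime (proc m d w) i s = max (min s (start m (w ∘ d) (d.symm i) + w i)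
      - start m (w ∘ d) (d.symm i)) 0 := by
  have h0 := start_nonneg m (w ∘ d) (d.symm i)
  have : {r : ℝ | r ∈ Ico 0 s ∧ i ∈ proc m d w r} = Ico (start m (w ∘ d) (d.symm i))
      (min s (start m (w ∘ d) (d.symm i) + w i)) := by
    ext r
    simp only [proc, Finset.mem_filter, Finset.mem_univ, true_and, mem_ofPred_eq, mem_Ico,
      lt_min_iff]
    constructor
    · rintro ⟨⟨_, h2⟩, h3, h4⟩
      exact ⟨h3, h2, h4⟩
    · rintro ⟨h3, h2, h4⟩
      exact ⟨⟨h0.trans h3, h2⟩, h3, h4⟩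
  rw [coreTime, this, Measure.real, Real.volume_Ico, ENNReal.toReal_ofReal']

theorem proc_congr {m : ℕ} (hm : 0 < m) (d : Equiv.Perm (Fin n)) (w w' : Fin n → ℝ) {s : ℝ}
    (hw : 0 ≤ w)
    (h : ∀ i, w' i = w i ∨
      (coreTime (proc m d w) i s < w i ∧ coreTime (proc m d w) i s < w' i))
    {r : ℝ} (hr : 0 ≤ r) (hrs : r ≤ s) : proc m d w' r = proc m d w r := by
  have key : ∀ k : Fin n, ∀ r, 0 ≤ r → r ≤ s →
      ((start m (w' ∘ d) k ≤ r ↔ start m (w ∘ d) k ≤ r) ∧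
        (r < start m (w' ∘ d) k + w' (d k) ↔ r < start m (w ∘ d) k + w (d k))) := by
    intro k
    induction k using WellFoundedLT.induction with
    | ind k ih =>
      have hst : ∀ r, 0 ≤ r → r ≤ s →
          (start m (w' ∘ d) k ≤ r ↔ start m (w ∘ d) k ≤ r) := by
        intro r hr hrs
        rw [start_le_iff hm _ _ hr, start_le_iff hm _ _ hr]
        have : (Finset.univ.filter fun j : {j : Fin n // j < k} =>
            r < start m (w' ∘ d) j.1 + (w' ∘ d) j.1) =
            (Finset.univ.filter fun j : {j : Fin n // j < k} =>
            r < start m (w ∘ d) j.1 + (w ∘ d) j.1) :=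
          Finset.filter_congr fun j _ => (ih j.1 j.2 r hr hrs).2
        rw [this]
      intro r hr hrs
      refine ⟨hst r hr hrs, ?_⟩
      have hs : 0 ≤ s := hr.trans hrs
      have hwk := hw (d k)
      simp only [Pi.zero_apply] at hwk
      rcases le_or_gt (start m (w ∘ d) k) s with hk | hk
      · have e : start m (w' ∘ d) k = start m (w ∘ d) k := by
          have a := (hst s hs le_rfl).2 hk
          exact le_antisymm ((hst _ (start_nonneg _ _ _) hk).2 le_rfl)
            ((hst _ (start_nonneg _ _ _) a).1 le_rfl)
        rcases h (d k) with h1 | ⟨h1, h2⟩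
        · rw [e, h1]
        · rw [coreTime_proc, Equiv.symm_apply_apply] at h1 h2
          have h3 : s < start m (w ∘ d) k + w (d k) := by
            by_contra hc
            rw [min_eq_right (not_lt.1 hc)] at h1
            have := le_max_left (start m (w ∘ d) k + w (d k) - start m (w ∘ d) k) 0
            linarith
          rw [min_eq_left h3.le] at h2
          have h4 := (le_max_left _ _).trans_lt h2
          rw [e]
          exact ⟨fun _ => by linarith, fun _ => by linarith⟩
      · have hk' : s < start m (w' ∘ d) k := by
          by_contra hc
          exact absurd ((hst s hs le_rfl).1 (not_lt.1 hc)) (not_le.2 hk)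
        have hwk' : 0 ≤ w' (d k) := by
          rcases h (d k) with h1 | ⟨_, h2⟩
          · rw [h1]; exact hwk
          · exact (measureReal_nonneg.trans_lt h2).le
        exact ⟨fun _ => by linarith, fun _ => by linarith⟩
  ext i
  have := key (d.symm i) r hr hrs
  simp only [Equiv.apply_symm_apply] at this
  simp only [proc, Finset.mem_filter, Finset.mem_univ, true_and, this.1, this.2]

end Greedy

/-! ### The policy LDF+Greedy -/

namespace SRTMIC

variable {n : ℕ} (M : SRTMIC n)

/-- Greedy scheduling of one period, for a random priority decision of law `D`. -/
def greedyRule (D : PMF (Equiv.Perm (Fin n))) : M.Rule :=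
  letI : MeasurableSpace (Equiv.Perm (Fin n)) := ⊤
  haveI : DiscreteMeasurableSpace (Equiv.Perm (Fin n)) := ⟨fun _ => trivial⟩
  { Seed := Equiv.Perm (Fin n)
    seedLaw := D.toMeasure
    isProbSeed := PMF.toMeasure.isProbabilityMeasure D
    proc := Greedy.proc M.m
    card_le := fun d w _ _ hs _ => Greedy.card_proc_le M.m_pos d w hs
    measurable := fun i => by
      have : {z : Equiv.Perm (Fin n) × (Fin n → ℝ) × ℝ |
          i ∈ Greedy.proc M.m z.1 z.2.1 z.2.2} =
          ⋃ d : Equiv.Perm (Fin n), {d} ×ˢ {z : (Fin n → ℝ) × ℝ |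
            i ∈ Greedy.proc M.m d z.1 z.2} := by
        ext ⟨d, z⟩
        simp
      rw [this]
      exact MeasurableSet.iUnion fun d =>
        (MeasurableSet.singleton d).prod (Greedy.measurableSet_proc M.m_pos d i)
    nonClairvoyant := fun d w w' _ hw _ _ h _ hr hrs =>
      Greedy.proc_congr M.m_pos d w w' hw h hr hrs }

/-- A rule that breaks the ties of LDF, possibly at random: for the requirement vector `q` and
the deficit vector `x` it draws a priority decision that sorts the deficits in decreasing
order. -/
structure LDFTieBreak (n : ℕ) where
  decision : (q x : Fin n → ℝ) → PMF (Equiv.Perm (Fin n))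
  sorted : ∀ q x, ∀ d ∈ (decision q x).support, Antitone (x ∘ d)

/-- LDF+Greedy with the tie-breaking rule `τ` and the initial states `init`. -/
def ldfGreedy (τ : LDFTieBreak n) (init : (Fin n → ℝ) → (Fin n → ℝ)) : M.Policy where
  control := fun q x => M.greedyRule (τ.decision q x)
  init := init

end SRTMIC

end

/-! The comparison is made in terms of work rather than completions. Below, `b` bounds the mean
workloads μ, and J is a set of highest priorities for some order of the users.

Upper bound for every rule. A non-clairvoyant rule that leaves a task uncompleted has learnt only
that its workload exceeds the time spent on it. With NBUE workloads, the mean work spent on a task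
is therefore at least its mean workload times its completion probability (`Rule.mean_mul_le`).
Greedy scheduling either starts all tasks of J before δ or keeps all m cores busy with J throughout
the period, so it starts at least as much work of J as any rule can perform. Hence Σ_J μ
P(completed), under any rule, is at most the mean workload of the tasks of J that greedy starts
(`Rule.sum_mean_mul_le`). A feasible q must then satisfy Σ_J μ q ≤ `meanStarted d J` for every order
d; otherwise a linear function of the deficits drifts upwards (`sum_mean_mul_le_meanStarted`).

Lower bound for greedy. The start of a task is independent of its own workload, so the mean started
workload is Σ_J μ P(started). If k tasks of J are cut off at δ, at least k cores worked on J all the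
time, so kδ is at most the started work. The cut-off tasks thus cost at most the fraction b/δ
(`mul_meanStarted_le`).

Stability. LDF sorts the deficits x, so summation by parts combines the inequalities over all J into
Σ μ x P(completed) ≥ (1 - b/δ) Σ μ x q. For rational γ < 1 - b/δ, a weighted sum of squared deficits
then has negative drift under the requirement γq, outside a set that contains only finitely many
reachable states because the requirements are rational. Foster's criterion gives positive
recurrence. The same drift shows that some initial state makes the chain irreducible, which is what
the assumption on the initial states needs. -/

noncomputable section

/-! ### Recurrence of chains -/

namespace Chain

variable {S : Type*}

open Classical in
/-- Expected value of `g` at the next state, on the event that this state is not `y`. -/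
def avoid (p : S → S → ℝ≥0∞) (y : S) (g : S → ℝ≥0∞) (x : S) : ℝ≥0∞ :=
  ∑' z, if z = y then 0 else p x z * g z

/-- The probability that the chain started at `x` is not at `y` at any of the times
`1, …, k`. -/
def survive (p : S → S → ℝ≥0∞) (y : S) : ℕ → S → ℝ≥0∞
  | 0 => fun _ => 1
  | k + 1 => avoid p y (survive p y k)

/-- `D` is a closed set of states on which the transition probabilities sum to one. -/
structure IsClosedOn (p : S → S → ℝ≥0∞) (D : Set S) : Prop where
  sum_eq : ∀ x ∈ D, ∑' z, p x z = 1
  closed : ∀ x ∈ D, ∀ z, CanStep p x z → z ∈ D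

variable {p : S → S → ℝ≥0∞} {D : Set S} {x y : S}

theorem avoid_mono {g h : S → ℝ≥0∞} (hgh : ∀ z, CanStep p x z → g z ≤ h z) :
    avoid p y g x ≤ avoid p y h x := by
  refine ENNReal.tsum_le_tsum fun z => ?_
  split_ifs
  · exact le_rfl
  · by_cases hz : p x z = 0
    · simp [hz]
    · gcongr
      exact hgh z hz

theorem avoid_add (g h : S → ℝ≥0∞) :
    avoid p y (fun z => g z + h z) x = avoid p y g x + avoid p y h x := by
  unfold avoid
  rw [← ENNReal.tsum_add]
  refine tsum_congr fun z => ?_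
  split_ifs
  · simp
  · rw [mul_add]

theorem avoid_const_mul (c : ℝ≥0∞) (g : S → ℝ≥0∞) :
    avoid p y (fun z => c * g z) x = c * avoid p y g x := by
  unfold avoid
  rw [← ENNReal.tsum_mul_left]
  refine tsum_congr fun z => ?_
  split_ifs
  · simp
  · rw [mul_left_comm]

theorem avoid_finset_sum {ι : Type*} (s : Finset ι) (g : ι → S → ℝ≥0∞) :
    avoid p y (fun z => ∑ i ∈ s, g i z) x = ∑ i ∈ s, avoid p y (g i) x := by
  classical
  induction s using Finset.induction_on with
  | empty => simp [avoid]
  | insert a s ha ih => simp only [Finset.sum_insert ha, avoid_add, ih]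

theorem avoid_add_eq (g : S → ℝ≥0∞) : avoid p y g x + p x y * g y = ∑' z, p x z * g z := by
  classical
  unfold avoid
  have : p x y * g y = ∑' z, if z = y then p x z * g z else 0 := by
    rw [tsum_eq_single y]
    · simp
    · intro z hz
      simp [hz]
  rw [this, ← ENNReal.tsum_add]
  refine tsum_congr fun z => ?_
  split_ifs <;> simp

theorem avoid_le (g : S → ℝ≥0∞) : avoid p y g x ≤ ∑' z, p x z * g z := by
  rw [← avoid_add_eq (y := y)]
  exact le_self_add

theorem firstPassage_add_survive (hD : IsClosedOn p D) (k : ℕ) (hx : x ∈ D) :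
    firstPassage p y k x + survive p y (k + 1) x = survive p y k x := by
  induction k generalizing x with
  | zero =>
    have := avoid_add_eq (p := p) (x := x) (y := y) (fun _ => 1)
    simp only [mul_one, hD.sum_eq x hx] at this
    change p x y + avoid p y (fun _ => 1) x = 1
    rw [add_comm, this]
  | succ k ih =>
    change avoid p y (firstPassage p y k) x + avoid p y (survive p y (k + 1)) x =
      avoid p y (survive p y k) x
    rw [← avoid_add]
    refine le_antisymm (avoid_mono fun z hz => ?_) (avoid_mono fun z hz => ?_)
    · exact (ih (hD.closed x hx z hz)).le
    · exact (ih (hD.closed x hx z hz)).ge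

theorem survive_succ_le (hD : IsClosedOn p D) (k : ℕ) (hx : x ∈ D) :
    survive p y (k + 1) x ≤ survive p y k x := by
  rw [← firstPassage_add_survive hD k hx]
  exact le_add_self

theorem survive_anti (hD : IsClosedOn p D) (hx : x ∈ D) :
    Antitone fun k => survive p y k x :=
  antitone_nat_of_succ_le fun k => survive_succ_le hD k hx

theorem survive_le_one (hD : IsClosedOn p D) (k : ℕ) (hx : x ∈ D) : survive p y k x ≤ 1 :=
  survive_anti hD hx (Nat.zero_le k)

theorem sum_firstPassage_add_survive (hD : IsClosedOn p D) (k : ℕ) (hx : x ∈ D) :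
    ∑ j ∈ Finset.range k, firstPassage p y j x + survive p y k x = 1 := by
  induction k with
  | zero => simp [survive]
  | succ k ih =>
    rw [Finset.sum_range_succ, add_assoc, firstPassage_add_survive hD k hx, ih]

/-- With T the first time ≥ 1 at which the chain is at `y`, `survive p y k x` is P(T > k), and both
sides are the mean of min(T, k). -/
theorem sum_mul_firstPassage_add (hD : IsClosedOn p D) (k : ℕ) (hx : x ∈ D) :
    ∑ j ∈ Finset.range k, ((j : ℝ≥0∞) + 1) * firstPassage p y j x + k * survive p y k x =
      ∑ j ∈ Finset.range k, survive p y j x := by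
  induction k with
  | zero => simp
  | succ k ih =>
    rw [Finset.sum_range_succ, Finset.sum_range_succ, ← ih, add_assoc, Nat.cast_add, Nat.cast_one,
      ← mul_add, firstPassage_add_survive hD k hx, add_mul, one_mul, ← add_assoc]

/-- A state is positive recurrent as soon as the expected return time is finite. -/
theorem positiveRecurrentState_of_tsum_survive (hD : IsClosedOn p D) (hy : y ∈ D)
    (h : ∑' k, survive p y k y ≠ ⊤) : PositiveRecurrentState p y := by
  have h0 := ENNReal.tendsto_atTop_zero_of_tsum_ne_top h
  constructor
  · have h1 := (ENNReal.summable (f := fun k => firstPassage p y k y)).hasSum.tendsto_sum_nat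
    have h2 := h1.add h0
    simp only [sum_firstPassage_add_survive hD _ hy, add_zero] at h2
    exact (tendsto_nhds_unique h2 tendsto_const_nhds)
  · refine lt_of_le_of_lt ?_ h.lt_top
    refine ENNReal.tsum_le_of_sum_range_le fun k => ?_
    calc _ ≤ ∑ j ∈ Finset.range k, survive p y j y := by
          rw [← sum_mul_firstPassage_add hD k hy]
          exact le_self_add
      _ ≤ _ := ENNReal.sum_le_tsum _

/-- First-step analysis: unrolling the inequality for `U` over `k` steps shows that it dominates the
mean of min(T, k), T being the hitting time of `y`. -/
theorem sum_survive_le (hD : IsClosedOn p D) {U : S → ℝ≥0∞}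
    (hU : ∀ x ∈ D, 1 + avoid p y U x ≤ U x) (k : ℕ) (hx : x ∈ D) :
    ∑ j ∈ Finset.range k, survive p y j x ≤ U x := by
  induction k generalizing x with
  | zero => simp
  | succ k ih =>
    rw [Finset.sum_range_succ', add_comm]
    refine le_trans ?_ (hU x hx)
    refine add_le_add le_rfl ?_
    change ∑ j ∈ Finset.range k, avoid p y (survive p y j) x ≤ _
    rw [← avoid_finset_sum]
    exact avoid_mono fun z hz => ih (hD.closed x hx z hz)

theorem exists_firstPassage_ne_zero (h : Relation.TransGen (CanStep p) x y) :
    ∃ k, firstPassage p y k x ≠ 0 := by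
  induction h using Relation.TransGen.head_induction_on with
  | single h => exact ⟨0, h⟩
  | @head a c h1 _ ih =>
    by_cases hc : c = y
    · exact ⟨0, hc ▸ h1⟩
    · obtain ⟨k, hk⟩ := ih
      refine ⟨k + 1, ?_⟩
      rw [firstPassage]
      intro h0
      have := ENNReal.tsum_eq_zero.1 h0 c
      simp only [hc, if_false, mul_eq_zero] at this
      exact this.elim h1 hk

theorem exists_survive_lt_one (hD : IsClosedOn p D) (hx : x ∈ D)
    (h : Relation.TransGen (CanStep p) x y) : ∃ k, survive p y k x < 1 := by
  obtain ⟨k, hk⟩ := exists_firstPassage_ne_zero h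
  refine ⟨k + 1, ?_⟩
  have h1 := firstPassage_add_survive (y := y) hD k hx
  have h2 := survive_le_one (y := y) hD k hx
  have h3 : survive p y (k + 1) x ≠ ⊤ :=
    ne_top_of_le_ne_top ENNReal.one_ne_top (survive_le_one hD _ hx)
  refine lt_of_lt_of_le ?_ h2
  rw [← h1, add_comm (firstPassage p y k x)]
  exact ENNReal.lt_add_right h3 hk

/-- Foster's criterion. -/
theorem positiveRecurrentState_of_drift (hD : IsClosedOn p D) (hy : y ∈ D)
    {V : S → ℝ≥0∞} {C : Set S} (hC : C.Finite) (b : ℝ≥0∞) (hb : b ≠ ⊤)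
    (hV : V y ≠ ⊤) (hCD : C ⊆ D)
    (hreach : ∀ x ∈ C, Relation.TransGen (CanStep p) x y)
    (hin : ∀ x ∈ C, ∑' z, p x z * V z ≤ V x + b)
    (hout : ∀ x ∈ D, x ∉ C → 1 + ∑' z, p x z * V z ≤ V x) : PositiveRecurrentState p y := by
  have h1 : ∀ x ∈ C, ∃ k, survive p y k x < 1 := fun x hx =>
    exists_survive_lt_one hD (hCD hx) (hreach x hx)
  choose! k hk using h1
  obtain ⟨N, hN⟩ := (hC.image k).bddAbove
  have hN1 : ∀ x ∈ C, survive p y (N + 1) x < 1 := fun x hx =>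
    lt_of_le_of_lt (survive_anti hD (hCD hx)
      ((hN (mem_image_of_mem k hx)).trans (Nat.le_succ N))) (hk x hx)
  obtain ⟨a, ha1, ha⟩ : ∃ a : ℝ≥0∞, a < 1 ∧ ∀ x ∈ C, survive p y (N + 1) x ≤ a := by
    refine ⟨hC.toFinset.sup (survive p y (N + 1)), ?_, fun x hx => ?_⟩
    · rw [Finset.sup_lt_iff (by simp)]
      intro x hx
      exact hN1 x (by simpa using hx)
    · exact Finset.le_sup (by simpa using hx)
  have ha0 : 1 - a ≠ 0 := (tsub_pos_of_lt ha1).ne'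
  have hat : a ≠ ⊤ := (ha1.trans ENNReal.one_lt_top).ne
  -- The drift may fail on `C`, so `V` is corrected by a multiple of `G`, the mean of min(T, N + 1).
  -- One step that avoids `y` never increases `G` in mean, and on `C` it decreases it by at least 1
  -- - a. The factor `K` makes this gain pay for `b` and leave the 1 needed in `hU`.
  set K : ℝ≥0∞ := (1 + b) / (1 - a) with hK
  have hKt : K ≠ ⊤ := ENNReal.div_ne_top (ENNReal.add_ne_top.2 ⟨ENNReal.one_ne_top, hb⟩) ha0
  set G : S → ℝ≥0∞ := fun x => ∑ j ∈ Finset.range (N + 1), survive p y j x with hG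
  have hGd : ∀ x, avoid p y G x + 1 = G x + survive p y (N + 1) x := by
    intro x
    simp only [hG]
    rw [← Finset.sum_range_succ (fun j => survive p y j x), Finset.sum_range_succ',
      avoid_finset_sum]
    rfl
  have hU : ∀ x ∈ D, 1 + avoid p y (fun z => V z + K * G z) x ≤ V x + K * G x := by
    intro x hx
    rw [avoid_add, avoid_const_mul]
    have hVx := avoid_le (p := p) (x := x) (y := y) V
    by_cases hxC : x ∈ C
    · have h2 : avoid p y G x + (1 - a) ≤ G x := by
        refine (ENNReal.add_le_add_iff_right hat).1 ?_
        rw [add_assoc, tsub_add_cancel_of_le ha1.le, hGd]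
        exact add_le_add le_rfl (ha x hxC)
      have h3 : K * avoid p y G x + (1 + b) ≤ K * G x := by
        have : K * (1 - a) = 1 + b := ENNReal.div_mul_cancel ha0
          (ne_top_of_le_ne_top ENNReal.one_ne_top tsub_le_self)
        rw [← this, ← mul_add]
        gcongr
      calc _ ≤ 1 + (V x + b + K * avoid p y G x) := by
            gcongr
            exact hVx.trans (hin x hxC)
        _ = V x + (K * avoid p y G x + (1 + b)) := by ring
        _ ≤ _ := by gcongr
    · have h2 : avoid p y G x ≤ G x := by
        refine (ENNReal.add_le_add_iff_right ENNReal.one_ne_top).1 ?_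
        rw [hGd]
        exact add_le_add le_rfl (survive_le_one hD _ hx)
      rw [← add_assoc]
      refine add_le_add ((add_le_add le_rfl hVx).trans (hout x hx hxC)) ?_
      gcongr
  refine positiveRecurrentState_of_tsum_survive hD hy ?_
  refine ne_top_of_le_ne_top ?_ (ENNReal.tsum_le_of_sum_range_le fun k =>
    sum_survive_le hD hU k hy)
  refine ENNReal.add_ne_top.2 ⟨hV, ENNReal.mul_ne_top hKt ?_⟩
  refine (ENNReal.sum_lt_top.2 fun j _ => ?_).ne
  exact (survive_le_one hD j hy).trans_lt ENNReal.one_lt_top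

theorem IsClosedOn.exists_canStep (hD : IsClosedOn p D) (hx : x ∈ D) : ∃ z, CanStep p x z := by
  by_contra! h
  have := hD.sum_eq x hx
  have h0 : ∀ z, p x z = 0 := fun z => by simpa [CanStep] using h z
  simp [h0] at this

theorem IsClosedOn.mem_of_reflTransGen (hD : IsClosedOn p D) (hx : x ∈ D)
    (h : Relation.ReflTransGen (CanStep p) x y) : y ∈ D := by
  induction h with
  | refl => exact hx
  | tail _ h ih => exact hD.closed _ ih _ h

theorem IsClosedOn.visited (hD : IsClosedOn p D) (hx : x ∈ D) :
    IsClosedOn p (visited p x) where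
  sum_eq z hz := hD.sum_eq z (hD.mem_of_reflTransGen hx (Relation.TransGen.to_reflTransGen hz))
  closed _ hz _ hzw := Relation.TransGen.tail hz hzw

/-- Foster's criterion for all states of an irreducible chain. -/
theorem positiveRecurrentFrom_of_drift (hD : IsClosedOn p D) (hx : x ∈ D)
    (hirr : IrreducibleFrom p x)
    {V : S → ℝ≥0∞} {C : Set S} (hC : C.Finite) (b : ℝ≥0∞) (hb : b ≠ ⊤)
    (hV : ∀ z, V z ≠ ⊤) (hCD : C ⊆ visited p x)
    (hin : ∀ x ∈ C, ∑' z, p x z * V z ≤ V x + b)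
    (hout : ∀ z ∈ visited p x, z ∉ C → 1 + ∑' w, p z w * V w ≤ V z) :
    PositiveRecurrentFrom p x := by
  intro y hy
  have hD' := hD.visited hx
  refine positiveRecurrentState_of_drift hD' hy hC b hb (hV y) hCD ?_ hin hout
  intro z hz
  obtain ⟨w, hw⟩ := hD'.exists_canStep (hCD hz)
  exact Relation.TransGen.head' hw (hirr w (hD'.closed z (hCD hz) w hw) y hy)

/-- If every successor had a value above V x - 1, so would the mean, against the drift. -/
theorem exists_canStep_add_one_le (hD : IsClosedOn p D) (hx : x ∈ D) {V : S → ℝ≥0∞}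
    (hV : V x ≠ ⊤) (h : 1 + ∑' z, p x z * V z ≤ V x) :
    ∃ z, CanStep p x z ∧ V z + 1 ≤ V x := by
  by_contra! hc
  obtain ⟨w, hw⟩ := hD.exists_canStep hx
  have hle1 : ∀ z, p x z ≤ 1 := fun z => hD.sum_eq x hx ▸ ENNReal.le_tsum z
  have h1 : ∑' z, p x z * V x < ∑' z, p x z * (V z + 1) := by
    refine ENNReal.tsum_lt_tsum (i := w) ?_ (fun z => ?_) ?_
    · rw [ENNReal.tsum_mul_right, hD.sum_eq x hx, one_mul]
      exact hV
    · by_cases hz : p x z = 0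
      · simp [hz]
      · gcongr
        exact (hc z hz).le
    · exact ENNReal.mul_lt_mul_right hw
        (ne_top_of_le_ne_top ENNReal.one_ne_top (hle1 w)) (hc w hw)
  simp only [mul_add, mul_one, ENNReal.tsum_add, ENNReal.tsum_mul_right, hD.sum_eq x hx,
    one_mul] at h1
  rw [add_comm] at h1
  exact absurd h1 (not_lt.2 h)

theorem exists_reflTransGen_mem (hD : IsClosedOn p D) {V : S → ℝ≥0∞} {C : Set S}
    (hV : ∀ z, V z ≠ ⊤)
    (hout : ∀ x ∈ D, x ∉ C → 1 + ∑' z, p x z * V z ≤ V x) (hx : x ∈ D) :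
    ∃ c ∈ C, Relation.ReflTransGen (CanStep p) x c := by
  obtain ⟨N, hN⟩ := ENNReal.exists_nat_gt (hV x)
  induction N generalizing x with
  | zero => simp at hN
  | succ N ih =>
    by_cases hxC : x ∈ C
    · exact ⟨x, hxC, .refl⟩
    · obtain ⟨z, hz, hzV⟩ := exists_canStep_add_one_le hD hx (hV x) (hout x hx hxC)
      have hlt : V z < N := by
        have := hzV.trans_lt hN
        push_cast at this
        exact (ENNReal.add_lt_add_iff_right ENNReal.one_ne_top).1 this
      obtain ⟨c, hc, hzc⟩ := ih (hD.closed x hx z hz) hlt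
      exact ⟨c, hc, .head hz hzc⟩

/-- If there is a drift towards a finite set, then some initial state makes the chain
irreducible. -/
theorem exists_irreducibleFrom (hD : IsClosedOn p D) {V : S → ℝ≥0∞} {C : Set S}
    (hC : C.Finite) (hCD : C ⊆ D) (hV : ∀ z, V z ≠ ⊤)
    (hout : ∀ x ∈ D, x ∉ C → 1 + ∑' z, p x z * V z ≤ V x) (hne : D.Nonempty) :
    ∃ x, IrreducibleFrom p x := by
  obtain ⟨x₀, hx₀⟩ := hne
  obtain ⟨c₀, hc₀, _⟩ := exists_reflTransGen_mem hD hV hout hx₀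
  set reach : S → Set S := fun x => {c ∈ C | Relation.ReflTransGen (CanStep p) x c} with hr
  have hfin : ∀ x, (reach x).Finite := fun x => hC.subset fun c hc => hc.1
  -- The start is a state of `C` from which the fewest states of `C` can be reached. A state of `C`
  -- reachable from it then reaches exactly the same part of `C`, hence leads back to `c`.
  obtain ⟨c, hc, hmin⟩ := hC.exists_minimalFor (fun x => (reach x).ncard) C ⟨c₀, hc₀⟩
  have key : ∀ c' ∈ reach c, Relation.ReflTransGen (CanStep p) c' c := by
    intro c' hc'
    have hsub : reach c' ⊆ reach c := fun z hz => ⟨hz.1, hc'.2.trans hz.2⟩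
    have := Set.eq_of_subset_of_ncard_le hsub
      (hmin hc'.1 (Set.ncard_le_ncard hsub (hfin c))) (hfin c)
    have hcc : c ∈ reach c' := this ▸ ⟨hc, .refl⟩
    exact hcc.2
  refine ⟨c, fun x hx y hy => ?_⟩
  have hx' := Relation.TransGen.to_reflTransGen hx
  obtain ⟨c', hc', hxc'⟩ := exists_reflTransGen_mem hD hV hout
    (hD.mem_of_reflTransGen (hCD hc) hx')
  exact (hxc'.trans (key c' ⟨hc', hx'.trans hxc'⟩)).trans (Relation.TransGen.to_reflTransGen hy)

/-! ### Upward drift excludes positive recurrence -/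

/-- Expected value of `f` after `k` steps, on the event that `y` has not been visited since
time `1`. -/
def surviveExpect (p : S → S → ℝ≥0∞) (y : S) (f : S → ℝ≥0∞) : ℕ → S → ℝ≥0∞
  | 0 => f
  | k + 1 => avoid p y (surviveExpect p y f k)

/-- Optional stopping at min(T, k): the value of `f`, less `c` times the elapsed time, is a
submartingale. The sum of the `survive` terms is the mean of min(T, k), and the stopped value is f y
with probability 1 - P(T > k). That term is moved to the left to avoid truncated subtraction. -/
theorem le_surviveExpect (hD : IsClosedOn p D) {f : S → ℝ≥0∞} {c : ℝ≥0∞}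
    (hf : ∀ x ∈ D, f x + c ≤ ∑' z, p x z * f z) (k : ℕ) (hx : x ∈ D) :
    f x + c * ∑ j ∈ Finset.range k, survive p y j x + f y * survive p y k x ≤
      surviveExpect p y f k x + f y := by
  induction k generalizing x with
  | zero => simp [survive, surviveExpect]
  | succ k ih =>
    have h1 : avoid p y (fun z => f z + c * ∑ j ∈ Finset.range k, survive p y j z +
        f y * survive p y k z) x ≤ avoid p y (fun z => surviveExpect p y f k z + f y * 1) x :=
      avoid_mono fun z hz => by simpa using ih (hD.closed x hx z hz)
    rw [avoid_add, avoid_add, avoid_const_mul, avoid_const_mul, avoid_finset_sum, avoid_add,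
      avoid_const_mul (f y) (fun _ => 1)] at h1
    have h2 := avoid_add_eq (p := p) (x := x) (y := y) f
    have h3 := avoid_add_eq (p := p) (x := x) (y := y) (fun _ => 1)
    simp only [mul_one, hD.sum_eq x hx] at h3
    rw [Finset.sum_range_succ']
    change f x + c * (∑ j ∈ Finset.range k, avoid p y (survive p y j) x + 1) +
      f y * avoid p y (survive p y k) x ≤ avoid p y (surviveExpect p y f k) x + f y
    calc _ = (f x + c) + c * ∑ j ∈ Finset.range k, avoid p y (survive p y j) x +
          f y * avoid p y (survive p y k) x := by ring
      _ ≤ (avoid p y f x + p x y * f y) + c * ∑ j ∈ Finset.range k, avoid p y (survive p y j) x +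
          f y * avoid p y (survive p y k) x := by
            rw [h2]
            gcongr
            exact hf x hx
      _ = (avoid p y f x + c * ∑ j ∈ Finset.range k, avoid p y (survive p y j) x +
          f y * avoid p y (survive p y k) x) + p x y * f y := by ring
      _ ≤ (avoid p y (surviveExpect p y f k) x + f y * avoid p y (fun _ => 1) x) + p x y * f y :=
            by gcongr
      _ = avoid p y (surviveExpect p y f k) x + f y * (avoid p y (fun _ => 1) x + p x y) := by
            ring
      _ = _ := by rw [h3, mul_one]

theorem surviveExpect_le (hD : IsClosedOn p D) {f : S → ℝ≥0∞} {K : ℝ≥0∞}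
    (hK : ∀ x ∈ D, ∀ z, CanStep p x z → f z ≤ f x + K) (k : ℕ) (hx : x ∈ D) :
    surviveExpect p y f k x ≤ (f x + K * k) * survive p y k x := by
  induction k generalizing x with
  | zero => simp [survive, surviveExpect]
  | succ k ih =>
    change avoid p y (surviveExpect p y f k) x ≤ _ * avoid p y (survive p y k) x
    rw [← avoid_const_mul]
    refine avoid_mono fun z hz => (ih (hD.closed x hx z hz)).trans ?_
    refine mul_le_mul' ?_ le_rfl
    calc f z + K * k ≤ f x + K + K * k := by gcongr; exact hK x hx z hz
      _ = _ := by push_cast; ring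

/-- k P(T > k) ≤ E[T; T > k], the tail of the convergent series for the mean return time. -/
theorem PositiveRecurrentState.tendsto (hD : IsClosedOn p D) (hy : y ∈ D)
    (h : PositiveRecurrentState p y) :
    Filter.Tendsto (fun k : ℕ => (k : ℝ≥0∞) * survive p y k y) Filter.atTop (nhds 0) := by
  have h1 := ENNReal.tendsto_sum_nat_add
    (fun k : ℕ => ((k : ℝ≥0∞) + 1) * firstPassage p y k y) h.2.ne
  refine tendsto_of_tendsto_of_tendsto_of_le_of_le tendsto_const_nhds h1
    (fun _ => zero_le) fun k => ?_
  have h2 : survive p y k y = ∑' j, firstPassage p y (j + k) y := by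
    have h3 := sum_firstPassage_add_survive (y := y) hD k hy
    have h4 := ENNReal.summable.sum_add_tsum_nat_add' (f := fun j => firstPassage p y j y) (k := k)
    rw [h.1, ← h3] at h4
    refine ((ENNReal.add_right_inj ?_).1 h4).symm
    refine ne_top_of_le_ne_top ENNReal.one_ne_top ?_
    rw [← h3]
    exact le_self_add
  simp only [h2]
  rw [← ENNReal.tsum_mul_left]
  refine ENNReal.tsum_le_tsum fun j => ?_
  gcongr
  push_cast
  exact le_add_right le_add_self

/-- A chain with a function whose value increases in expectation by at least a positive constant
in each step, but never by more than another constant, is not positive recurrent. -/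
theorem not_positiveRecurrentState_of_drift (hD : IsClosedOn p D) (hy : y ∈ D)
    {f : S → ℝ≥0∞} (hfy : f y ≠ ⊤) {c K : ℝ≥0∞} (hc : c ≠ 0) (hKt : K ≠ ⊤)
    (hf : ∀ x ∈ D, f x + c ≤ ∑' z, p x z * f z)
    (hK : ∀ x ∈ D, ∀ z, CanStep p x z → f z ≤ f x + K) : ¬ PositiveRecurrentState p y := by
  intro h
  have h1 := ENNReal.Tendsto.const_mul (a := K) (h.tendsto hD hy) (Or.inr hKt)
  rw [mul_zero] at h1
  have h2 : ∀ k : ℕ, c ≤ K * ((k + 1 : ℕ) * survive p y (k + 1) y) := by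
    intro k
    have h3 := (le_surviveExpect (y := y) hD hf (k + 1) hy).trans
      (add_le_add (surviveExpect_le hD hK (k + 1) hy) le_rfl)
    have h4 : c ≤ c * ∑ j ∈ Finset.range (k + 1), survive p y j y := by
      rw [Finset.sum_range_succ', mul_add]
      simp only [survive, mul_one]
      exact le_add_self
    have hs : survive p y (k + 1) y ≠ ⊤ :=
      ne_top_of_le_ne_top ENNReal.one_ne_top (survive_le_one hD _ hy)
    have h5 : f y * survive p y (k + 1) y + f y ≠ ⊤ :=
      ENNReal.add_ne_top.2 ⟨ENNReal.mul_ne_top hfy hs, hfy⟩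
    -- Starting at `y` itself, the terms with f y cancel between the two bounds on `surviveExpect`.
    -- What remains is c E[min(T, k + 1)] ≤ K (k + 1) P(T > k + 1), whose right side tends to zero.
    refine (ENNReal.add_le_add_iff_left h5).1 ?_
    calc _ ≤ f y * survive p y (k + 1) y + f y +
          c * ∑ j ∈ Finset.range (k + 1), survive p y j y := by gcongr
      _ = f y + c * ∑ j ∈ Finset.range (k + 1), survive p y j y +
          f y * survive p y (k + 1) y := by ring
      _ ≤ _ := h3
      _ = _ := by ring
  have h6 := ge_of_tendsto' ((Filter.tendsto_add_atTop_iff_nat 1).2 h1) h2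
  exact hc (le_antisymm h6 zero_le)

end Chain

/-! ### Core time as an integral over the period -/

section CoreTime

variable {n : ℕ} {a : ℝ → Finset (Fin n)}

theorem coreTime_eq_integral {i : Fin n} (h : MeasurableSet {r | i ∈ a r}) (s : ℝ) :
    coreTime a i s = ∫ r in Ico 0 s, {r | i ∈ a r}.indicator 1 r := by
  rw [integral_indicator_one h, measureReal_restrict_apply h, coreTime]
  congr 1
  ext r
  exact and_comm

theorem integrableOn_indicator_mem {i : Fin n} (h : MeasurableSet {r | i ∈ a r}) (s : ℝ) :
    IntegrableOn ({r | i ∈ a r}.indicator (1 : ℝ → ℝ)) (Ico 0 s) :=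
  IntegrableOn.indicator (integrableOn_const (by simp)) h

theorem sum_indicator_mem (A : Finset (Fin n)) (r : ℝ) :
    ∑ i ∈ A, {r | i ∈ a r}.indicator (1 : ℝ → ℝ) r = (A.filter (· ∈ a r)).card := by
  simp [Finset.card_filter, indicator_apply]

theorem sum_coreTime_le {A : Finset (Fin n)} (h : ∀ i ∈ A, MeasurableSet {r | i ∈ a r}) {s c : ℝ}
    (hs : 0 ≤ s) (hc : ∀ r ∈ Ico 0 s, ((A.filter (· ∈ a r)).card : ℝ) ≤ c) :
    ∑ i ∈ A, coreTime a i s ≤ c * s := by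
  rw [Finset.sum_congr rfl fun i hi => coreTime_eq_integral (h i hi) s,
    ← integral_finsetSum _ fun i hi => integrableOn_indicator_mem (h i hi) s]
  calc _ ≤ ∫ _ in Ico 0 s, c := by
        refine setIntegral_mono_on (integrable_finsetSum _ fun i hi =>
          integrableOn_indicator_mem (h i hi) s) (integrableOn_const (by simp))
          measurableSet_Ico fun r hr => ?_
        rw [sum_indicator_mem]
        exact hc r hr
    _ = c * s := by
        rw [setIntegral_const, Measure.real, Real.volume_Ico, sub_zero, ENNReal.toReal_ofReal hs,
          smul_eq_mul, mul_comm]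

theorem le_sum_coreTime {A : Finset (Fin n)} (h : ∀ i ∈ A, MeasurableSet {r | i ∈ a r}) {s c : ℝ}
    (hs : 0 ≤ s) (hc : ∀ r ∈ Ico 0 s, c ≤ (A.filter (· ∈ a r)).card) :
    c * s ≤ ∑ i ∈ A, coreTime a i s := by
  rw [Finset.sum_congr rfl fun i hi => coreTime_eq_integral (h i hi) s,
    ← integral_finsetSum _ fun i hi => integrableOn_indicator_mem (h i hi) s]
  calc c * s = ∫ _ in Ico 0 s, c := by
        rw [setIntegral_const, Measure.real, Real.volume_Ico, sub_zero, ENNReal.toReal_ofReal hs,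
          smul_eq_mul, mul_comm]
    _ ≤ _ := by
        refine setIntegral_mono_on (integrableOn_const (by simp)) (integrable_finsetSum _ fun i hi =>
          integrableOn_indicator_mem (h i hi) s)
          measurableSet_Ico fun r hr => ?_
        rw [sum_indicator_mem]
        exact hc r hr

theorem coreTime_nonneg (i : Fin n) (s : ℝ) : 0 ≤ coreTime a i s := measureReal_nonneg

end CoreTime

/-! ### Work started by greedy scheduling -/

namespace Greedy

variable {n : ℕ}

/-- While enough tasks of a set of highest priorities are uncompleted, that many of them are
being processed. -/
theorem le_card_proc {m : ℕ} (hm : 0 < m) (v : Fin n → ℝ) {J : Finset (Fin n)}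
    (hJ : IsLowerSet (J : Set (Fin n))) {s : ℝ} (hs : 0 ≤ s) {c : ℕ} (hcm : c ≤ m)
    (hc : c ≤ (J.filter fun j => s < start m v j + v j).card) :
    c ≤ (J.filter (· ∈ proc m (Equiv.refl _) v s)).card := by
  by_contra! hlt
  obtain ⟨j₁, hj₁, hj₁'⟩ := Finset.exists_mem_notMem_of_card_lt_card (hlt.trans_le hc)
  -- Take the highest priority in `J` that is uncompleted but not in process. It has not started, so
  -- at least m tasks of higher priority are uncompleted. They lie in the lower set `J` and, by
  -- minimality, are all in process, contrary to `hlt` and c ≤ m.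
  obtain ⟨j₀, hj₀, hmin⟩ := ((J.filter fun j => s < start m v j + v j) \
    (J.filter (· ∈ proc m (Equiv.refl _) v s))).exists_minimal
    ⟨j₁, Finset.mem_sdiff.2 ⟨hj₁, hj₁'⟩⟩
  obtain ⟨h1, h2⟩ := Finset.mem_sdiff.1 hj₀
  obtain ⟨h1, h3⟩ := Finset.mem_filter.1 h1
  have h4 : ¬ start m v j₀ ≤ s := by
    intro h
    refine h2 (Finset.mem_filter.2 ⟨h1, ?_⟩)
    simp only [proc, Finset.mem_filter, Finset.mem_univ, true_and]
    exact ⟨h, h3⟩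
  rw [start_le_iff hm v j₀ hs, not_lt] at h4
  refine absurd (hcm.trans h4) (not_le.2 (lt_of_le_of_lt ?_ hlt))
  rw [← Finset.card_map (Function.Embedding.subtype _)]
  refine Finset.card_le_card fun j hj => ?_
  simp only [Finset.mem_map, Finset.mem_filter, Finset.mem_univ, true_and] at hj
  obtain ⟨j', hj', rfl⟩ := hj
  have hjJ : j'.1 ∈ J := hJ j'.2.le h1
  by_contra hcon
  refine absurd (hmin (Finset.mem_sdiff.2 ⟨Finset.mem_filter.2 ⟨hjJ, hj'⟩, hcon⟩) j'.2.le)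
    (not_le.2 j'.2)

/-- The total workload of the tasks with priorities in `J` that start before time `δ`. -/
def startedWork (m : ℕ) (δ : ℝ) (J : Finset (Fin n)) (v : Fin n → ℝ) : ℝ :=
  ∑ j ∈ J, if start m v j < δ then v j else 0

theorem sum_coreTime_le_startedWork (m : ℕ) {δ : ℝ} (J : Finset (Fin n)) {v : Fin n → ℝ}
    (hv : 0 ≤ v) :
    ∑ j ∈ J, coreTime (proc m (Equiv.refl _) v) j δ ≤ startedWork m δ J v := by
  refine Finset.sum_le_sum fun j _ => ?_
  rw [coreTime_proc]
  change max (min δ (start m v j + v j) - start m v j) 0 ≤ _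
  have := hv j
  simp only [Pi.zero_apply] at this
  split_ifs with h
  · refine max_le ?_ this
    have := min_le_right δ (start m v j + v j)
    linarith
  · refine max_le ?_ le_rfl
    have := min_le_left δ (start m v j + v j)
    linarith

theorem measurableSet_mem_proc {m : ℕ} (hm : 0 < m) (v : Fin n → ℝ) (j : Fin n) :
    MeasurableSet {r | j ∈ proc m (Equiv.refl _) v r} :=
  measurable_prodMk_left (measurableSet_proc hm (Equiv.refl _) j)

/-- The tasks that are in process at the end of the period have kept as many cores busy all the
time. -/
theorem card_mul_le_startedWork {m : ℕ} (hm : 0 < m) {δ : ℝ} (hδ : 0 < δ) {J : Finset (Fin n)}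
    (hJ : IsLowerSet (J : Set (Fin n))) {v : Fin n → ℝ} (hv : 0 ≤ v) :
    ((J.filter fun j => start m v j < δ ∧ δ < start m v j + v j).card : ℝ) * δ ≤
      startedWork m δ J v := by
  refine le_trans ?_ (sum_coreTime_le_startedWork m J hv)
  set A := J.filter fun j => start m v j < δ ∧ δ < start m v j + v j with hA
  refine le_sum_coreTime (fun j _ => measurableSet_mem_proc hm v j) hδ.le fun s hs => ?_
  refine Nat.cast_le.2 (le_card_proc hm v hJ hs.1 ?_ ?_)
  · rcases A.eq_empty_or_nonempty with h | h
    · simp [h]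
    · obtain ⟨j₀, hj₀, hmax⟩ := A.exists_max_image (start m v) h
      refine le_trans ?_ (card_proc_le hm (Equiv.refl _) v (start_nonneg m v j₀))
      refine Finset.card_le_card fun j hj => ?_
      have h1 := (Finset.mem_filter.1 hj).2
      have h2 := (Finset.mem_filter.1 hj₀).2
      simp only [proc, Finset.mem_filter, Finset.mem_univ, true_and]
      exact ⟨hmax j hj, h2.1.trans h1.2⟩
  · refine Finset.card_le_card fun j hj => ?_
    have h1 := Finset.mem_filter.1 hj
    exact Finset.mem_filter.2 ⟨h1.1, hs.2.trans h1.2.2⟩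

/-- Greedy scheduling starts at least as much work as any schedule can complete. -/
theorem sum_min_le_startedWork {m : ℕ} (hm : 0 < m) {δ : ℝ} (hδ : 0 < δ) {J : Finset (Fin n)}
    (hJ : IsLowerSet (J : Set (Fin n))) {v : Fin n → ℝ} (hv : 0 ≤ v) {z : Fin n → ℝ}
    (hz : ∑ j ∈ J, z j ≤ m * δ) :
    ∑ j ∈ J, min (v j) (z j) ≤ startedWork m δ J v := by
  -- If all tasks of `J` start, the started work is their whole workload. If one has not started
  -- before δ, at least m tasks of `J` are uncompleted at each earlier time, so all cores work on
  -- `J` and perform m δ.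
  by_cases hall : ∀ j ∈ J, start m v j < δ
  · refine Finset.sum_le_sum fun j hj => ?_
    rw [if_pos (hall j hj)]
    exact min_le_left _ _
  · push Not at hall
    obtain ⟨j₀, hj₀, hle⟩ := hall
    calc _ ≤ ∑ j ∈ J, z j := Finset.sum_le_sum fun j _ => min_le_right _ _
      _ ≤ m * δ := hz
      _ ≤ ∑ j ∈ J, coreTime (proc m (Equiv.refl _) v) j δ := by
        refine le_sum_coreTime (fun j _ => measurableSet_mem_proc hm v j) hδ.le fun s hs => ?_
        refine Nat.cast_le.2 (le_card_proc hm v hJ hs.1 le_rfl ?_)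
        have h4 : ¬ start m v j₀ ≤ s := not_le.2 (hs.2.trans_le hle)
        rw [start_le_iff hm v j₀ hs.1, not_lt] at h4
        refine h4.trans ?_
        rw [← Finset.card_map (Function.Embedding.subtype _)]
        refine Finset.card_le_card fun j hj => ?_
        simp only [Finset.mem_map, Finset.mem_filter, Finset.mem_univ, true_and] at hj
        obtain ⟨j', hj', rfl⟩ := hj
        exact Finset.mem_filter.2 ⟨hJ j'.2.le hj₀, hj'⟩
      _ ≤ _ := sum_coreTime_le_startedWork m J hv

/-- The start of a task does not depend on its workload. -/
theorem start_update (m : ℕ) (v : Fin n → ℝ) (j : Fin n) (u : ℝ) :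
    start m (Function.update v j u) j = start m v j := by
  have key : ∀ k : Fin n, k ≤ j → start m (Function.update v j u) k = start m v k := by
    intro k
    induction k using WellFoundedLT.induction with
    | ind k ih =>
      intro hk
      rw [start, start]
      congr 1
      ext s
      have : (Finset.univ.filter fun i : {i : Fin n // i < k} =>
          s < start m (Function.update v j u) i.1 + Function.update v j u i.1) =
          (Finset.univ.filter fun i : {i : Fin n // i < k} => s < start m v i.1 + v i.1) := by
        refine Finset.filter_congr fun i _ => ?_
        rw [ih i.1 i.2 (i.2.le.trans hk), Function.update_of_ne (i.2.trans_le hk).ne]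
      simp only [Set.mem_ofPred_eq, this]
  exact key j le_rfl

end Greedy

/-! ### Replacing one coordinate -/

/-- Replacing one coordinate by an independent copy does not change a product law. -/
theorem measurePreserving_update {n : ℕ} (ν : Fin n → Measure ℝ) [∀ i, IsProbabilityMeasure (ν i)]
    (i : Fin n) :
    MeasurePreserving (fun z : (Fin n → ℝ) × ℝ => Function.update z.1 i z.2)
      ((Measure.pi ν).prod (ν i)) (Measure.pi ν) := by
  have hmeas : Measurable fun z : (Fin n → ℝ) × ℝ => Function.update z.1 i z.2 := by
    refine measurable_pi_lambda _ fun j => ?_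
    by_cases h : j = i
    · subst h
      simpa using measurable_snd
    · simp only [Function.update_of_ne h]
      exact (measurable_pi_apply j).comp measurable_fst
  refine ⟨hmeas, (Measure.pi_eq fun s hs => ?_).symm⟩
  rw [Measure.map_apply hmeas (MeasurableSet.univ_pi hs)]
  have : (fun z : (Fin n → ℝ) × ℝ => Function.update z.1 i z.2) ⁻¹' univ.pi s =
      (univ.pi (Function.update s i univ)) ×ˢ s i := by
    ext z
    simp only [mem_preimage, mem_univ_pi, mem_prod]
    constructor
    · intro h
      refine ⟨fun j => ?_, by simpa using h i⟩
      by_cases hj : j = i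
      · subst hj; simp
      · simpa [Function.update_of_ne hj] using h j
    · rintro ⟨h1, h2⟩ j
      by_cases hj : j = i
      · subst hj; simpa using h2
      · simpa [Function.update_of_ne hj] using h1 j
  rw [this, Measure.prod_prod, Measure.pi_pi, ← Finset.prod_erase_mul _ _ (Finset.mem_univ i),
    ← Finset.prod_erase_mul (a := i) _ (fun j => ν j (s j)) (Finset.mem_univ i)]
  simp only [Function.update_self, measure_univ, mul_one]
  congr 1
  refine Finset.prod_congr rfl fun j hj => ?_
  rw [Function.update_of_ne (Finset.ne_of_mem_erase hj)]

/-! ### NBUE laws -/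

/-- E[min(W, t)] = E[W] - E[W - t; W > t], and NBUE bounds the subtracted term by E[W] P(W > t). -/
theorem IsNBUE.mul_le_integral_min {ν : Measure ℝ} [IsProbabilityMeasure ν] (h : IsNBUE ν)
    (hν : ∀ᵐ w ∂ν, 0 ≤ w) (hi : Integrable (fun w : ℝ => w) ν) {t : ℝ} (ht : 0 ≤ t) :
    (∫ w, w ∂ν) * ν.real (Iic t) ≤ ∫ w, min w t ∂ν := by
  have hmin : ∀ t : ℝ, Integrable (fun w : ℝ => min w t) ν := fun t =>
    hi.inf (integrable_const t)
  have hpos : ∀ t : ℝ, 0 < t → (∫ w, w ∂ν) * ν.real (Iic t) ≤ ∫ w, min w t ∂ν := by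
    intro t ht
    have hsplit : ∫ w, min w t ∂ν = ∫ w, w ∂ν - ∫ w in Ioi t, (w - t) ∂ν := by
      have hi' : Integrable ((Ioi t).indicator fun w => w - t) ν :=
        (hi.sub (integrable_const t)).indicator measurableSet_Ioi
      rw [← integral_indicator measurableSet_Ioi, ← integral_sub hi hi']
      refine integral_congr_ae (Filter.Eventually.of_forall fun w => ?_)
      by_cases hw : t < w
      · simp [hw, hw.le]
      · simp [hw, not_lt.1 hw]
    have hcompl : ν.real (Iic t) = 1 - ν.real (Ioi t) := by
      rw [← compl_Ioi, probReal_compl_eq_one_sub measurableSet_Ioi]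
    have hle : ∫ w in Ioi t, (w - t) ∂ν ≤ (∫ w, w ∂ν) * ν.real (Ioi t) := by
      by_cases h0 : ν (Ioi t) = 0
      · rw [Measure.restrict_eq_zero.2 h0, Measure.real, h0]
        simp
      · have h1 := h t ht h0
        rw [ProbabilityTheory.cond, integral_smul_measure, ENNReal.toReal_inv, smul_eq_mul] at h1
        have h2 : 0 < ν.real (Ioi t) := ENNReal.toReal_pos h0 (measure_ne_top _ _)
        rw [← Measure.real, inv_mul_le_iff₀ h2] at h1
        linarith
    rw [hsplit, hcompl]
    linarith
  rcases ht.lt_or_eq with ht | rfl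
  · exact hpos t ht
  · have h0 : ∫ w, min w 0 ∂ν = 0 := by
      rw [integral_eq_zero_of_ae]
      filter_upwards [hν] with w hw
      simpa using hw
    rw [h0]
    -- NBUE speaks only of positive t; the case t = 0 is the limit t ↓ 0, where E[min(W, t)] ≤ t.
    refine le_of_forall_pos_le_add fun t ht => ?_
    calc _ ≤ (∫ w, w ∂ν) * ν.real (Iic t) := by
          refine mul_le_mul_of_nonneg_left ?_ (integral_nonneg_of_ae hν)
          exact measureReal_mono (Iic_subset_Iic.2 ht.le)
      _ ≤ ∫ w, min w t ∂ν := hpos t ht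
      _ ≤ ∫ _, t ∂ν := integral_mono (hmin t) (integrable_const t) fun w => min_le_right _ _
      _ = 0 + t := by simp

/-- The bound on the mean work for a task whose processing time `z u`, as a function of its
workload `u`, is non-clairvoyant. -/
theorem IsNBUE.mul_le_integral_min_of_nonClairvoyant {ν : Measure ℝ} [IsProbabilityMeasure ν]
    (h : IsNBUE ν) (hν : ∀ᵐ w ∂ν, 0 ≤ w) (hi : Integrable (fun w : ℝ => w) ν) {z : ℝ → ℝ}
    (hz0 : ∀ u, 0 ≤ z u) (hz : ∀ u u', 0 ≤ u → z u < u → z u < u' → z u' = z u) :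
    (∫ w, w ∂ν) * ν.real {u | u ≤ z u} ≤ ∫ u, min u (z u) ∂ν := by
  -- One uncompleted workload `u₀` determines a deterministic cutoff z u₀: longer workloads receive
  -- exactly this time, and workloads up to it are completed, since otherwise the rule could not
  -- tell them from `u₀`. Without such a `u₀` all non-negative workloads are completed and the
  -- minimum is the workload itself.
  by_cases hex : ∃ u₀, 0 ≤ u₀ ∧ z u₀ < u₀
  · obtain ⟨u₀, hu₀, hlt⟩ := hex
    have h1 : ∀ u, z u₀ < u → z u = z u₀ := fun u hu => hz u₀ u hu₀ hlt hu
    have h2 : ∀ u, 0 ≤ u → u ≤ z u₀ → u ≤ z u := by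
      intro u hu hle
      by_contra! hc
      have := hz u u₀ hu hc (hc.trans (hle.trans_lt hlt))
      linarith
    have h3 : {u | u ≤ z u} =ᵐ[ν] Iic (z u₀) := by
      filter_upwards [hν] with u hu
      refine propext ⟨fun hle => ?_, fun hle => h2 u hu hle⟩
      change u ≤ z u₀
      by_contra! hc
      have h4 : u ≤ z u := hle
      rw [h1 u hc] at h4
      exact absurd hc (not_lt.2 h4)
    have h5 : ∫ u, min u (z u) ∂ν = ∫ u, min u (z u₀) ∂ν := by
      refine integral_congr_ae ?_
      filter_upwards [hν] with u hu
      rcases le_or_gt u (z u₀) with hle | hgt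
      · rw [min_eq_left hle, min_eq_left (h2 u hu hle)]
      · rw [h1 u hgt]
    rw [measureReal_congr h3, h5]
    exact h.mul_le_integral_min hν hi (hz0 u₀)
  · push Not at hex
    have h5 : ∫ u, min u (z u) ∂ν = ∫ u, u ∂ν := by
      refine integral_congr_ae ?_
      filter_upwards [hν] with u hu
      rw [min_eq_left (hex u hu)]
    rw [h5]
    exact mul_le_of_le_one_right (integral_nonneg_of_ae hν) measureReal_le_one

/-! ### Work and completions in one period -/

namespace SRTMIC

variable {n : ℕ} (M : SRTMIC n)

theorem mean_nonneg (i : Fin n) : 0 ≤ M.mean i := integral_nonneg_of_ae (M.nonneg i)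

theorem ae_nonneg : ∀ᵐ w ∂(Measure.pi M.workload), 0 ≤ w := by
  have : ∀ᵐ w ∂(Measure.pi M.workload), ∀ i, 0 ≤ w i := by
    rw [ae_all_iff]
    intro i
    exact (measurePreserving_eval M.workload i).quasiMeasurePreserving.ae (M.nonneg i)
  filter_upwards [this] with w hw using hw

theorem integrable_eval (i : Fin n) :
    Integrable (fun w : Fin n → ℝ => w i) (Measure.pi M.workload) :=
  (measurePreserving_eval M.workload i).integrable_comp_of_integrable (M.integrable i)

variable {M}

namespace Rule

variable (R : M.Rule)

theorem measurable_coreTime (i : Fin n) :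
    Measurable fun z : R.Seed × (Fin n → ℝ) => coreTime (R.proc z.1 z.2) i M.δ := by
  have hs : MeasurableSet {z : (R.Seed × (Fin n → ℝ)) × ℝ |
      z.2 ∈ Ico 0 M.δ ∧ i ∈ R.proc z.1.1 z.1.2 z.2} :=
    (measurable_snd measurableSet_Ico).inter
      (MeasurableEquiv.prodAssoc.measurable (R.measurable i))
  exact (measurable_measure_prodMk_left (ν := volume) hs).ennreal_toReal

theorem mem_completed {ω : R.Seed} {w : Fin n → ℝ} {i : Fin n} :
    i ∈ R.completed ω w ↔ w i ≤ coreTime (R.proc ω w) i M.δ := by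
  simp [completed]

theorem measurableSet_mem_completed (i : Fin n) :
    MeasurableSet {z : R.Seed × (Fin n → ℝ) | i ∈ R.completed z.1 z.2} := by
  simp only [mem_completed]
  exact measurableSet_le ((measurable_pi_apply i).comp measurable_snd) (R.measurable_coreTime i)

theorem measurableSet_mem_completed_section (ω : R.Seed) (i : Fin n) :
    MeasurableSet {w : Fin n → ℝ | i ∈ R.completed ω w} :=
  measurable_prodMk_left (R.measurableSet_mem_completed i)

theorem measurable_coreTime_section (ω : R.Seed) (i : Fin n) :
    Measurable fun w : Fin n → ℝ => coreTime (R.proc ω w) i M.δ := by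
  have h : Measurable fun w : Fin n → ℝ => (ω, w) := measurable_prodMk_left
  have key : ∀ f : R.Seed × (Fin n → ℝ) → ℝ, Measurable f → Measurable fun w => f (ω, w) :=
    fun f hf => hf.comp h
  exact key _ (R.measurable_coreTime i)

theorem integrable_min_coreTime (ω : R.Seed) (i : Fin n) :
    Integrable (fun w : Fin n → ℝ => min (w i) (coreTime (R.proc ω w) i M.δ))
      (Measure.pi M.workload) := by
  refine (M.integrable_eval i).mono
    ((measurable_pi_apply i).min (R.measurable_coreTime_section ω i)).aestronglyMeasurable ?_
  filter_upwards [M.ae_nonneg] with w hw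
  have h0 : 0 ≤ w i := hw i
  rw [Real.norm_of_nonneg (le_min h0 (coreTime_nonneg _ _)), Real.norm_of_nonneg h0]
  exact min_le_left _ _

/-- The two workloads cannot be told apart by the end of the period, as both exceed the time spent
on the task. This is the hypothesis on `z` in the NBUE bound. -/
theorem coreTime_update (ω : R.Seed) {w : Fin n → ℝ} (hw : 0 ≤ w) (i : Fin n) {u u' : ℝ}
    (hu : 0 ≤ u) (h : coreTime (R.proc ω (Function.update w i u)) i M.δ < u)
    (h' : coreTime (R.proc ω (Function.update w i u)) i M.δ < u') :
    coreTime (R.proc ω (Function.update w i u')) i M.δ =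
      coreTime (R.proc ω (Function.update w i u)) i M.δ := by
  have key := R.nonClairvoyant ω (Function.update w i u) (Function.update w i u') M.δ ?_
    M.δ_pos.le le_rfl ?_
  · unfold coreTime
    congr 1
    ext r
    simp only [Set.mem_ofPred_eq]
    refine and_congr_right fun hr => ?_
    rw [key r hr.1 hr.2.le]
  · intro j
    by_cases hj : j = i
    · subst hj
      simpa using hu
    · rw [Function.update_of_ne hj]
      exact hw j
  · intro j
    by_cases hj : j = i
    · subst hj
      right
      simpa using ⟨h, h'⟩
    · left
      rw [Function.update_of_ne hj, Function.update_of_ne hj]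

/-- With NBUE workloads, the mean work spent on a task is at least its mean workload times the
probability that it is completed. -/
theorem mean_mul_le (hNBUE : ∀ i, IsNBUE (M.workload i)) (ω : R.Seed) (i : Fin n) :
    M.mean i * (Measure.pi M.workload).real {w | i ∈ R.completed ω w} ≤
      ∫ w, min (w i) (coreTime (R.proc ω w) i M.δ) ∂(Measure.pi M.workload) := by
  have hmp := measurePreserving_update M.workload i
  set Z : (Fin n → ℝ) → ℝ := fun w => coreTime (R.proc ω w) i M.δ with hZ
  set φ : (Fin n → ℝ) → ℝ := fun w => min (w i) (Z w) -
    M.mean i * {w | i ∈ R.completed ω w}.indicator 1 w with hφ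
  have hcm := R.measurableSet_mem_completed_section ω i
  have hind : Integrable ({w | i ∈ R.completed ω w}.indicator (1 : (Fin n → ℝ) → ℝ))
      (Measure.pi M.workload) := (integrable_const (1 : ℝ)).indicator hcm
  have hφi : Integrable φ (Measure.pi M.workload) :=
    (R.integrable_min_coreTime ω i).sub (hind.const_mul _)
  have hφu : Integrable (fun z : (Fin n → ℝ) × ℝ => φ (Function.update z.1 i z.2))
      ((Measure.pi M.workload).prod (M.workload i)) := hmp.integrable_comp_of_integrable hφi
  suffices h : 0 ≤ ∫ w, φ w ∂(Measure.pi M.workload) by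
    simp only [hφ] at h
    rw [integral_sub (R.integrable_min_coreTime ω i) (hind.const_mul _), integral_const_mul,
      integral_indicator_one hcm] at h
    linarith
  -- The workload of user `i` is resampled independently. With the randomization and the other
  -- workloads fixed, the inner integral is the one-dimensional NBUE bound.
  rw [← hmp.map_eq, integral_map hmp.measurable.aemeasurable (by
      rw [hmp.map_eq]
      exact hφi.aestronglyMeasurable),
    integral_prod _ hφu]
  refine integral_nonneg_of_ae ?_
  filter_upwards [M.ae_nonneg] with w hw
  have h1 := (hNBUE i).mul_le_integral_min_of_nonClairvoyant (M.nonneg i) (M.integrable i)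
    (z := fun u => Z (Function.update w i u)) (fun u => coreTime_nonneg _ _)
    (fun u u' hu h h' => R.coreTime_update ω hw i hu h h')
  have hup : Measurable fun u : ℝ => Function.update w i u := measurable_update w
  have hms : MeasurableSet {u | u ≤ Z (Function.update w i u)} :=
    measurableSet_le measurable_id ((R.measurable_coreTime_section ω i).comp hup)
  have hmi : Integrable (fun u => min u (Z (Function.update w i u))) (M.workload i) := by
    refine (M.integrable i).mono (measurable_id.min
      ((R.measurable_coreTime_section ω i).comp hup)).aestronglyMeasurable ?_
    filter_upwards [M.nonneg i] with u hu
    rw [Real.norm_of_nonneg (le_min hu (coreTime_nonneg _ _)), Real.norm_of_nonneg hu]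
    exact min_le_left _ _
  have h2 : ∀ u, φ (Function.update w i u) = min u (Z (Function.update w i u)) -
      M.mean i * {u | u ≤ Z (Function.update w i u)}.indicator 1 u := by
    intro u
    simp only [hφ, Function.update_self, indicator_apply, Set.mem_ofPred_eq, mem_completed, hZ,
      Pi.one_apply]
  simp only [Pi.zero_apply, h2]
  have hsi : Integrable ({u | u ≤ Z (Function.update w i u)}.indicator (1 : ℝ → ℝ))
      (M.workload i) := (integrable_const (1 : ℝ)).indicator hms
  rw [integral_sub hmi (hsi.const_mul _), integral_const_mul, integral_indicator_one hms]
  unfold mean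
  linarith

end Rule

/-- The mean workload of the tasks with priorities in `J` that start in a period under greedy
scheduling with priority decision `d`. -/
def meanStarted (M : SRTMIC n) (d : Equiv.Perm (Fin n)) (J : Finset (Fin n)) : ℝ :=
  ∫ w, Greedy.startedWork M.m M.δ J (w ∘ d) ∂(Measure.pi M.workload)

theorem measurable_comp_perm (d : Equiv.Perm (Fin n)) :
    Measurable fun w : Fin n → ℝ => w ∘ d :=
  measurable_pi_lambda _ fun j => measurable_pi_apply (d j)

theorem measurableSet_start_lt (M : SRTMIC n) (d : Equiv.Perm (Fin n)) (j : Fin n) :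
    MeasurableSet {w : Fin n → ℝ | Greedy.start M.m (w ∘ d) j < M.δ} :=
  measurableSet_lt ((Greedy.measurable_start M.m_pos j).comp (measurable_comp_perm d))
    measurable_const

theorem integrable_started (M : SRTMIC n) (d : Equiv.Perm (Fin n)) (j : Fin n) :
    Integrable (fun w : Fin n → ℝ => if Greedy.start M.m (w ∘ d) j < M.δ then (w ∘ d) j else 0)
      (Measure.pi M.workload) :=
  (M.integrable_eval (d j)).indicator (M.measurableSet_start_lt d j)

theorem integrable_startedWork (M : SRTMIC n) (d : Equiv.Perm (Fin n)) (J : Finset (Fin n)) :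
    Integrable (fun w : Fin n → ℝ => Greedy.startedWork M.m M.δ J (w ∘ d))
      (Measure.pi M.workload) :=
  integrable_finsetSum _ fun j _ => M.integrable_started d j

/-- Whether a task starts in a period is independent of its workload. -/
theorem meanStarted_eq (M : SRTMIC n) (d : Equiv.Perm (Fin n)) (J : Finset (Fin n)) :
    M.meanStarted d J = ∑ j ∈ J, M.mean (d j) *
      (Measure.pi M.workload).real {w | Greedy.start M.m (w ∘ d) j < M.δ} := by
  unfold meanStarted Greedy.startedWork
  rw [integral_finsetSum _ fun j _ => M.integrable_started d j]
  refine Finset.sum_congr rfl fun j _ => ?_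
  have hmp := measurePreserving_update M.workload (d j)
  have hi := M.integrable_started d j
  conv_lhs => rw [← hmp.map_eq]
  rw [integral_map hmp.measurable.aemeasurable (by
      rw [hmp.map_eq]
      exact hi.aestronglyMeasurable)]
  have : ∀ z : (Fin n → ℝ) × ℝ,
      (if Greedy.start M.m (Function.update z.1 (d j) z.2 ∘ d) j < M.δ then
        (Function.update z.1 (d j) z.2 ∘ d) j else 0) =
      {w | Greedy.start M.m (w ∘ d) j < M.δ}.indicator 1 z.1 * z.2 := by
    intro z
    have h1 : Function.update z.1 (d j) z.2 ∘ d = Function.update (z.1 ∘ d) j z.2 := by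
      rw [Function.update_comp_eq_of_injective _ d.injective]
    rw [h1, Greedy.start_update, Function.update_self]
    simp [indicator_apply]
  simp only [this]
  rw [integral_prod_mul (fun w : Fin n → ℝ =>
    {w | Greedy.start M.m (w ∘ d) j < M.δ}.indicator (1 : (Fin n → ℝ) → ℝ) w) (fun u : ℝ => u),
    integral_indicator_one (M.measurableSet_start_lt d j), mul_comm]
  rfl

/-- No rule completes, in terms of mean workloads, more than greedy scheduling starts. -/
theorem Rule.sum_mean_mul_le (hNBUE : ∀ i, IsNBUE (M.workload i)) (R : M.Rule) (ω : R.Seed)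
    (d : Equiv.Perm (Fin n)) {J : Finset (Fin n)} (hJ : IsLowerSet (J : Set (Fin n))) :
    ∑ j ∈ J, M.mean (d j) * (Measure.pi M.workload).real {w | d j ∈ R.completed ω w} ≤
      M.meanStarted d J := by
  calc _ ≤ ∑ j ∈ J, ∫ w, min (w (d j)) (coreTime (R.proc ω w) (d j) M.δ)
        ∂(Measure.pi M.workload) := Finset.sum_le_sum fun j _ => R.mean_mul_le hNBUE ω (d j)
    _ = ∫ w, ∑ j ∈ J, min (w (d j)) (coreTime (R.proc ω w) (d j) M.δ)
        ∂(Measure.pi M.workload) :=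
          (integral_finsetSum _ fun j _ => R.integrable_min_coreTime ω (d j)).symm
    _ ≤ _ := by
      refine integral_mono_ae (integrable_finsetSum _ fun j _ => R.integrable_min_coreTime ω (d j))
        (M.integrable_startedWork d J) ?_
      filter_upwards [M.ae_nonneg] with w hw
      refine Greedy.sum_min_le_startedWork M.m_pos M.δ_pos hJ (fun j => hw (d j)) ?_
      have hsum : ∑ j ∈ J, coreTime (R.proc ω w) (d j) M.δ =
          ∑ i ∈ J.map d.toEmbedding, coreTime (R.proc ω w) i M.δ := by
        rw [Finset.sum_map]
        rfl
      rw [hsum]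
      refine sum_coreTime_le (fun i _ => ?_) M.δ_pos.le fun r hr => ?_
      · exact measurable_prodMk_left (measurable_prodMk_left (R.measurable i))
      · refine Nat.cast_le.2 (le_trans (Finset.card_le_card fun i hi => ?_)
          (R.card_le ω w r hw hr.1 hr.2))
        exact (Finset.mem_filter.1 hi).2

/-- In terms of mean workloads, greedy scheduling completes at least the fraction
`1 - b / δ` of what it starts, `b` being a bound on the mean workloads. -/
theorem mul_meanStarted_le (M : SRTMIC n) {b : ℝ} (hb : ∀ i, M.mean i ≤ b)
    (d : Equiv.Perm (Fin n)) {J : Finset (Fin n)} (hJ : IsLowerSet (J : Set (Fin n))) :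
    (1 - b / M.δ) * M.meanStarted d J ≤ ∑ j ∈ J, M.mean (d j) * (Measure.pi M.workload).real
      {w | w (d j) ≤ coreTime (Greedy.proc M.m d w) (d j) M.δ} := by
  have hcm : ∀ j, MeasurableSet
      {w : Fin n → ℝ | w (d j) ≤ coreTime (Greedy.proc M.m d w) (d j) M.δ} := by
    intro j
    simp only [Greedy.coreTime_proc, Equiv.symm_apply_apply]
    have h1 : Measurable fun w : Fin n → ℝ => Greedy.start M.m (w ∘ d) j :=
      (Greedy.measurable_start M.m_pos j).comp (measurable_comp_perm d)
    have h2 : Measurable fun w : Fin n → ℝ => w (d j) := measurable_pi_apply (d j)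
    exact measurableSet_le h2 (((measurable_const.min (h1.add h2)).sub h1).max measurable_const)
  set c : Fin n → (Fin n → ℝ) → ℝ := fun j =>
    {w | w (d j) ≤ coreTime (Greedy.proc M.m d w) (d j) M.δ}.indicator 1 with hc
  set s : Fin n → (Fin n → ℝ) → ℝ := fun j =>
    {w | Greedy.start M.m (w ∘ d) j < M.δ}.indicator 1 with hs
  have hci : ∀ j, Integrable (fun w => M.mean (d j) * c j w) (Measure.pi M.workload) :=
    fun j => ((integrable_const (1 : ℝ)).indicator (hcm j)).const_mul _
  have hsi : ∀ j, Integrable (fun w => M.mean (d j) * s j w) (Measure.pi M.workload) :=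
    fun j => ((integrable_const (1 : ℝ)).indicator (M.measurableSet_start_lt d j)).const_mul _
  -- For each realization, a started task that is not completed runs beyond δ. Each such task loses
  -- a mean of at most `b`, and their number is at most the started work divided by δ.
  have hpath : ∀ᵐ w ∂(Measure.pi M.workload), ∑ j ∈ J, M.mean (d j) * s j w ≤
      ∑ j ∈ J, M.mean (d j) * c j w + b / M.δ * Greedy.startedWork M.m M.δ J (w ∘ d) := by
    filter_upwards [M.ae_nonneg] with w hw
    have h1 := Greedy.card_mul_le_startedWork M.m_pos M.δ_pos hJ
      (v := w ∘ d) (fun j => hw (d j))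
    rcases J.eq_empty_or_nonempty with rfl | ⟨j₀, hj₀⟩
    · simp [Greedy.startedWork]
    have hb0 : 0 ≤ b := (M.mean_nonneg (d j₀)).trans (hb _)
    have h2 : b * ((J.filter fun j => Greedy.start M.m (w ∘ d) j < M.δ ∧
        M.δ < Greedy.start M.m (w ∘ d) j + (w ∘ d) j).card : ℝ) ≤
        b / M.δ * Greedy.startedWork M.m M.δ J (w ∘ d) := by
      rw [div_mul_eq_mul_div, le_div_iff₀ M.δ_pos, mul_assoc]
      exact mul_le_mul_of_nonneg_left h1 hb0
    refine le_trans ?_ (add_le_add le_rfl h2)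
    rw [Finset.card_filter, Nat.cast_sum, Finset.mul_sum, ← Finset.sum_add_distrib]
    refine Finset.sum_le_sum fun j _ => ?_
    have hm0 := M.mean_nonneg (d j)
    have hmb := hb (d j)
    have hc0 : 0 ≤ c j w := indicator_nonneg (fun _ _ => zero_le_one) w
    simp only [hs, indicator_apply, Set.mem_ofPred_eq, Pi.one_apply]
    split_ifs with h3 h4
    · push_cast
      nlinarith [mul_nonneg hm0 hc0]
    · have h5 : c j w = 1 := by
        simp only [hc]
        refine indicator_of_mem ?_ _
        have h6 : Greedy.start M.m (w ∘ d) j + w (d j) ≤ M.δ := by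
          by_contra! h7
          exact h4 ⟨h3, h7⟩
        change w (d j) ≤ _
        rw [Greedy.coreTime_proc, Equiv.symm_apply_apply, min_eq_right h6]
        refine le_trans ?_ (le_max_left _ _)
        linarith
      rw [h5]
      simp
    · push_cast
      nlinarith [mul_nonneg hm0 hc0]
    · push_cast
      nlinarith [mul_nonneg hm0 hc0]
  have hint := integral_mono_ae (integrable_finsetSum J fun j _ => hsi j)
    ((integrable_finsetSum J fun j _ => hci j).add
      ((M.integrable_startedWork d J).const_mul (b / M.δ))) hpath
  have e1 : ∫ w, ∑ j ∈ J, M.mean (d j) * s j w ∂(Measure.pi M.workload) = M.meanStarted d J := by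
    rw [meanStarted_eq, integral_finsetSum _ fun j _ => hsi j]
    refine Finset.sum_congr rfl fun j _ => ?_
    rw [integral_const_mul]
    congr 1
    exact integral_indicator_one (M.measurableSet_start_lt d j)
  have e2 : ∫ w, ∑ j ∈ J, M.mean (d j) * c j w ∂(Measure.pi M.workload) =
      ∑ j ∈ J, M.mean (d j) * (Measure.pi M.workload).real
        {w | w (d j) ≤ coreTime (Greedy.proc M.m d w) (d j) M.δ} := by
    rw [integral_finsetSum _ fun j _ => hci j]
    refine Finset.sum_congr rfl fun j _ => ?_
    rw [integral_const_mul]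
    congr 1
    exact integral_indicator_one (hcm j)
  have e3 := integral_add (integrable_finsetSum J fun j _ => hci j)
    ((M.integrable_startedWork d J).const_mul (b / M.δ))
  simp only [Pi.add_apply] at hint e3
  rw [e1, e3, e2, integral_const_mul] at hint
  unfold meanStarted at hint ⊢
  linarith

end SRTMIC

/-- Summation by parts: a sum with decreasing non-negative weights is non-negative if all
partial sums are. -/
theorem sum_mul_nonneg_of_antitone {n : ℕ} {x a : Fin n → ℝ} (hx : Antitone x)
    (hx0 : ∀ j, 0 ≤ x j)
    (ha : ∀ J : Finset (Fin n), IsLowerSet (J : Set (Fin n)) → 0 ≤ ∑ j ∈ J, a j) :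
    0 ≤ ∑ j, x j * a j := by
  -- The bound with a general lower bound t on the weights survives the induction: the first n terms
  -- are bounded with t the last weight, and this weight may then be lowered to t because the total
  -- of `a` is non-negative.
  suffices h : ∀ t, (∀ j, t ≤ x j) → t * ∑ j, a j ≤ ∑ j, x j * a j by
    simpa using h 0 hx0
  clear hx0
  induction n with
  | zero => simp
  | succ n ih =>
    intro t ht
    have h1 := ih (x := fun j => x j.castSucc) (a := fun j => a j.castSucc)
      (fun i j hij => hx (Fin.castSucc_le_castSucc_iff.2 hij)) (fun J hJ => by
        have h2 := ha (J.map Fin.castSuccEmb) ?_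
        · simpa using h2
        · intro i j hij hi
          simp only [Finset.coe_map, Fin.coe_castSuccEmb, Set.mem_image, Finset.mem_coe] at hi ⊢
          obtain ⟨i', hi', rfl⟩ := hi
          have hlt : j < Fin.last n := hij.trans_lt (Fin.castSucc_lt_last i')
          refine ⟨j.castPred hlt.ne, hJ ?_ hi', by simp⟩
          rwa [← Fin.castSucc_le_castSucc_iff, Fin.castSucc_castPred])
      (x (Fin.last n)) (fun j => hx (Fin.le_last _))
    have h3 := ha Finset.univ (by simpa using isLowerSet_univ)
    rw [Fin.sum_univ_castSucc] at h3 ⊢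
    rw [Fin.sum_univ_castSucc (fun j => x j * a j)]
    nlinarith [ht (Fin.last n)]

/-! ### Completion probabilities averaged over the randomization -/

namespace SRTMIC

variable {n : ℕ} {M : SRTMIC n}

namespace Rule

variable (R : M.Rule)

/-- The probability that `C` is the set of users whose tasks are completed. -/
def law (C : Finset (Fin n)) : ℝ :=
  (R.seedLaw.prod (Measure.pi M.workload)).real {z | R.completed z.1 z.2 = C}

/-- The probability that the task of user `i` is completed. -/
def prob (i : Fin n) : ℝ :=
  (R.seedLaw.prod (Measure.pi M.workload)).real {z | i ∈ R.completed z.1 z.2}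

theorem measurableSet_completed_eq (C : Finset (Fin n)) :
    MeasurableSet {z : R.Seed × (Fin n → ℝ) | R.completed z.1 z.2 = C} := by
  have : {z : R.Seed × (Fin n → ℝ) | R.completed z.1 z.2 = C} =
      ⋂ i, {z | i ∈ R.completed z.1 z.2 ↔ i ∈ C} := by
    ext z
    simp [Finset.ext_iff]
  rw [this]
  refine MeasurableSet.iInter fun i => ?_
  by_cases hi : i ∈ C
  · simpa [hi] using R.measurableSet_mem_completed i
  · simp only [hi, iff_false]
    exact (R.measurableSet_mem_completed i).compl

theorem law_nonneg (C : Finset (Fin n)) : 0 ≤ R.law C := measureReal_nonneg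

theorem sum_law_mul (g : Finset (Fin n) → ℝ) :
    ∑ C, R.law C * g C =
      ∫ z, g (R.completed z.1 z.2) ∂(R.seedLaw.prod (Measure.pi M.workload)) := by
  have h1 : ∀ z : R.Seed × (Fin n → ℝ), g (R.completed z.1 z.2) =
      ∑ C, {z | R.completed z.1 z.2 = C}.indicator 1 z * g C := by
    intro z
    rw [Finset.sum_eq_single (R.completed z.1 z.2)]
    · simp
    · intro C _ hC
      simp [hC.symm]
    · simp
  simp only [h1]
  have h2 : ∀ C, Integrable ({z : R.Seed × (Fin n → ℝ) | R.completed z.1 z.2 = C}.indicator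
      (1 : R.Seed × (Fin n → ℝ) → ℝ)) (R.seedLaw.prod (Measure.pi M.workload)) := fun C =>
    (integrable_const (1 : ℝ)).indicator (R.measurableSet_completed_eq C)
  rw [integral_finsetSum _ fun C _ => (h2 C).mul_const (g C)]
  refine Finset.sum_congr rfl fun C _ => ?_
  rw [integral_mul_const, integral_indicator_one (R.measurableSet_completed_eq C)]
  rfl

theorem sum_law : ∑ C, R.law C = 1 := by
  simpa using R.sum_law_mul fun _ => 1

theorem sum_law_mul_ite (i : Fin n) : ∑ C, R.law C * (if i ∈ C then 1 else 0) = R.prob i := by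
  rw [R.sum_law_mul fun C => if i ∈ C then 1 else 0, prob,
    ← integral_indicator_one (R.measurableSet_mem_completed i)]
  simp [indicator_apply]

theorem integrable_section (i : Fin n) :
    Integrable (fun ω => (Measure.pi M.workload).real {w | i ∈ R.completed ω w}) R.seedLaw := by
  have hm : Measurable fun ω => (Measure.pi M.workload).real {w | i ∈ R.completed ω w} :=
    (measurable_measure_prodMk_left (R.measurableSet_mem_completed i)).ennreal_toReal
  refine Integrable.of_bound hm.aestronglyMeasurable 1 (Filter.Eventually.of_forall fun ω => ?_)
  rw [Real.norm_of_nonneg measureReal_nonneg]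
  exact measureReal_le_one

theorem prob_eq_integral (i : Fin n) :
    R.prob i = ∫ ω, (Measure.pi M.workload).real {w | i ∈ R.completed ω w} ∂(R.seedLaw) := by
  rw [prob, ← integral_indicator_one (R.measurableSet_mem_completed i),
    integral_prod _ (show Integrable ({z : R.Seed × (Fin n → ℝ) | i ∈ R.completed z.1 z.2}.indicator
      (1 : R.Seed × (Fin n → ℝ) → ℝ)) _ from
        (integrable_const (1 : ℝ)).indicator (R.measurableSet_mem_completed i))]
  refine integral_congr_ae (Filter.Eventually.of_forall fun ω => ?_)
  exact integral_indicator_one (R.measurableSet_mem_completed_section ω i)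

theorem sum_mul_prob {ι : Type*} (s : Finset ι) (c : ι → ℝ) (e : ι → Fin n) :
    ∑ j ∈ s, c j * R.prob (e j) = ∫ ω, ∑ j ∈ s, c j *
      (Measure.pi M.workload).real {w | e j ∈ R.completed ω w} ∂(R.seedLaw) := by
  rw [integral_finsetSum _ fun j _ => (R.integrable_section (e j)).const_mul (c j)]
  refine Finset.sum_congr rfl fun j _ => ?_
  rw [integral_const_mul, prob_eq_integral]

theorem le_sum_mul_prob {ι : Type*} (s : Finset ι) (c : ι → ℝ) (e : ι → Fin n) {a : ℝ}
    (h : ∀ᵐ ω ∂(R.seedLaw), a ≤ ∑ j ∈ s, c j *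
      (Measure.pi M.workload).real {w | e j ∈ R.completed ω w}) :
    a ≤ ∑ j ∈ s, c j * R.prob (e j) := by
  rw [sum_mul_prob]
  calc a = ∫ _, a ∂(R.seedLaw) := by simp
    _ ≤ _ := integral_mono_ae (integrable_const _) (integrable_finsetSum _ fun j _ =>
      (R.integrable_section (e j)).const_mul (c j)) h

theorem sum_mul_prob_le {ι : Type*} (s : Finset ι) (c : ι → ℝ) (e : ι → Fin n) {a : ℝ}
    (h : ∀ ω, ∑ j ∈ s, c j *
      (Measure.pi M.workload).real {w | e j ∈ R.completed ω w} ≤ a) :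
    ∑ j ∈ s, c j * R.prob (e j) ≤ a := by
  rw [sum_mul_prob]
  calc _ ≤ ∫ _, a ∂(R.seedLaw) := integral_mono (integrable_finsetSum _ fun j _ =>
      (R.integrable_section (e j)).const_mul (c j)) (integrable_const _) h
    _ = a := by simp

theorem prob_eq_one_of_mean_eq_zero {i : Fin n} (hi : M.mean i = 0) : R.prob i = 1 := by
  have h0 : ∀ᵐ w ∂(Measure.pi M.workload), w i = 0 :=
    (measurePreserving_eval M.workload i).quasiMeasurePreserving.ae
      ((integral_eq_zero_iff_of_nonneg_ae (M.nonneg i) (M.integrable i)).1 hi)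
  have h1 : ∀ ω, (Measure.pi M.workload).real {w | i ∈ R.completed ω w} = 1 := by
    intro ω
    have : {w | i ∈ R.completed ω w} =ᵐ[Measure.pi M.workload] univ := by
      filter_upwards [h0] with w hw
      refine propext ⟨fun _ => trivial, fun _ => ?_⟩
      change i ∈ R.completed ω w
      rw [mem_completed, hw]
      exact coreTime_nonneg _ _
    rw [measureReal_congr this, probReal_univ]
  rw [prob_eq_integral]
  simp [h1]

end Rule

/-! ### Transitions and drift of the deficits -/

theorem deficitStep_nonneg (q x : Fin n → ℝ) (C : Finset (Fin n)) (i : Fin n) :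
    0 ≤ deficitStep q x C i := le_max_right _ _

/-- From a given state there are only finitely many outcomes, one for each set of completed tasks,
so sums over the uncountable state space become finite. -/
theorem trans_eq_sum (η : M.Control) (q x y : Fin n → ℝ) :
    trans η q x y = ∑ C, if deficitStep q x C = y then ENNReal.ofReal ((η q x).law C) else 0 := by
  classical
  set R := η q x with hR
  have h1 : {z : R.Seed × (Fin n → ℝ) | deficitStep q x (R.completed z.1 z.2) = y} =
      ⋃ C ∈ Finset.univ.filter (fun C => deficitStep q x C = y),
        {z | R.completed z.1 z.2 = C} := by
    ext z
    simp
  have h2 : trans η q x y = (R.seedLaw.prod (Measure.pi M.workload))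
      {z : R.Seed × (Fin n → ℝ) | deficitStep q x (R.completed z.1 z.2) = y} := rfl
  rw [h2, h1, measure_biUnion_finset ?_ fun C _ => R.measurableSet_completed_eq C,
    Finset.sum_filter]
  · refine Finset.sum_congr rfl fun C _ => ?_
    rw [Rule.law, ofReal_measureReal]
  · intro C _ C' _ hne
    refine Set.disjoint_left.2 fun z hz hz' => hne ?_
    exact (show R.completed z.1 z.2 = C from hz).symm.trans hz'

theorem tsum_trans_mul (η : M.Control) (q x : Fin n → ℝ) (g : (Fin n → ℝ) → ℝ≥0∞) :
    ∑' y, trans η q x y * g y =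
      ∑ C, ENNReal.ofReal ((η q x).law C) * g (deficitStep q x C) := by
  simp only [trans_eq_sum, Finset.sum_mul]
  rw [Summable.tsum_finsetSum fun _ _ => ENNReal.summable]
  refine Finset.sum_congr rfl fun C _ => ?_
  rw [tsum_eq_single (deficitStep q x C)]
  · simp
  · intro y hy
    simp [hy.symm]

theorem tsum_trans_mul_ofReal (η : M.Control) (q x : Fin n → ℝ) {g : (Fin n → ℝ) → ℝ}
    (hg : ∀ C, 0 ≤ g (deficitStep q x C)) :
    ∑' y, trans η q x y * ENNReal.ofReal (g y) =
      ENNReal.ofReal (∑ C, (η q x).law C * g (deficitStep q x C)) := by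
  rw [tsum_trans_mul, ENNReal.ofReal_sum_of_nonneg fun C _ =>
    mul_nonneg ((η q x).law_nonneg C) (hg C)]
  refine Finset.sum_congr rfl fun C _ => ?_
  rw [ENNReal.ofReal_mul ((η q x).law_nonneg C)]

theorem exists_of_canStep {η : M.Control} {q x y : Fin n → ℝ}
    (h : Chain.CanStep (trans η q) x y) : ∃ C, y = deficitStep q x C := by
  by_contra! hc
  refine h ?_
  rw [trans_eq_sum]
  exact Finset.sum_eq_zero fun C _ => if_neg fun hC => hc C hC.symm

theorem isClosedOn_nonneg (η : M.Control) (q : Fin n → ℝ) :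
    Chain.IsClosedOn (trans η q) {x | ∀ i, 0 ≤ x i} where
  sum_eq x _ := by
    have := tsum_trans_mul_ofReal η q x (g := fun _ => 1) fun _ => zero_le_one
    simpa [Rule.sum_law] using this
  closed x _ y h i := by
    obtain ⟨C, rfl⟩ := exists_of_canStep h
    exact deficitStep_nonneg q x C i

theorem isClosedOn_univ (η : M.Control) (q : Fin n → ℝ) :
    Chain.IsClosedOn (trans η q) univ where
  sum_eq x _ := by
    have := tsum_trans_mul_ofReal η q x (g := fun _ => 1) fun _ => zero_le_one
    simpa [Rule.sum_law] using this
  closed _ _ _ _ := trivial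

theorem nonneg_of_visited {η : M.Control} {q x₀ x : Fin n → ℝ}
    (h : x ∈ Chain.visited (trans η q) x₀) (i : Fin n) : 0 ≤ x i := by
  obtain ⟨y, _, hy⟩ := Relation.TransGen.tail'_iff.1 h
  obtain ⟨C, rfl⟩ := exists_of_canStep hy
  exact deficitStep_nonneg _ _ C i

/-- A necessary condition for feasibility. -/
theorem sum_mean_mul_le_meanStarted (hNBUE : ∀ i, IsNBUE (M.workload i)) {η : M.Policy}
    {q : Fin n → ℝ} (hq : q ∈ region η) (d : Equiv.Perm (Fin n)) {J : Finset (Fin n)}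
    (hJ : IsLowerSet (J : Set (Fin n))) :
    ∑ j ∈ J, M.mean (d j) * q (d j) ≤ M.meanStarted d J := by
  by_contra! hlt
  obtain ⟨hreq, _, hpos⟩ := hq
  -- Recurrence is known only for states visited from time 1 on, and the initial state need not be
  -- one of them.
  obtain ⟨y, hy⟩ := (isClosedOn_univ η.control q).exists_canStep (mem_univ (η.init q))
  have hyv : y ∈ Chain.visited (trans η.control q) (η.init q) := Relation.TransGen.single hy
  -- Deficits grow by q less the completions, up to truncation that only raises them. In mean, `f`
  -- thus increases by at least f q - `meanStarted d J` > 0 from every non-negative state, and never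
  -- by more than f q.
  set f : (Fin n → ℝ) → ℝ := fun x => ∑ j ∈ J, M.mean (d j) * x (d j) with hf
  have hf0 : ∀ x : Fin n → ℝ, (∀ i, 0 ≤ x i) → 0 ≤ f x := fun x hx =>
    Finset.sum_nonneg fun j _ => mul_nonneg (M.mean_nonneg _) (hx _)
  refine Chain.not_positiveRecurrentState_of_drift (isClosedOn_nonneg η.control q)
    (y := y) (nonneg_of_visited hyv) (f := fun x => ENNReal.ofReal (f x)) ENNReal.ofReal_ne_top
    (c := ENNReal.ofReal (f q - M.meanStarted d J)) (K := ENNReal.ofReal (f q)) ?_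
    ENNReal.ofReal_ne_top ?_ ?_ (hpos y hyv)
  · simpa using hlt
  · intro x hx
    rw [tsum_trans_mul_ofReal η.control q x fun C => hf0 _ (deficitStep_nonneg q x C),
      ← ENNReal.ofReal_add (hf0 x hx) (sub_nonneg.2 hlt.le)]
    refine ENNReal.ofReal_le_ofReal ?_
    set R := η.control q x
    have h1 : ∑ j ∈ J, M.mean (d j) * R.prob (d j) ≤ M.meanStarted d J :=
      R.sum_mul_prob_le J _ _ fun ω => R.sum_mean_mul_le hNBUE ω d hJ
    have h2 : ∑ C, R.law C * (f x + f q - ∑ j ∈ J, M.mean (d j) * if d j ∈ C then 1 else 0) =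
        f x + f q - ∑ j ∈ J, M.mean (d j) * R.prob (d j) := by
      simp only [mul_sub, Finset.sum_sub_distrib, ← Finset.sum_mul, R.sum_law, one_mul,
        Finset.mul_sum]
      rw [Finset.sum_comm]
      congr 1
      refine Finset.sum_congr rfl fun j _ => ?_
      rw [← R.sum_law_mul_ite, Finset.mul_sum]
      exact Finset.sum_congr rfl fun C _ => mul_left_comm _ _ _
    calc f x + (f q - M.meanStarted d J) ≤ _ := by
          rw [← add_sub_assoc]
          exact sub_le_sub_left h1 _
      _ = _ := h2.symm
      _ ≤ _ := by
          refine Finset.sum_le_sum fun C _ => mul_le_mul_of_nonneg_left ?_ (R.law_nonneg C)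
          simp only [hf]
          rw [← Finset.sum_add_distrib, ← Finset.sum_sub_distrib]
          refine Finset.sum_le_sum fun j _ => ?_
          rw [← mul_add, ← mul_sub]
          exact mul_le_mul_of_nonneg_left (le_max_left _ _) (M.mean_nonneg _)
  · intro x hx z hz
    obtain ⟨C, rfl⟩ := exists_of_canStep hz
    rw [← ENNReal.ofReal_add (hf0 x hx) (hf0 q fun i => (hreq i).1)]
    refine ENNReal.ofReal_le_ofReal ?_
    simp only [hf]
    rw [← Finset.sum_add_distrib]
    refine Finset.sum_le_sum fun j _ => ?_
    rw [← mul_add]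
    refine mul_le_mul_of_nonneg_left (max_le ?_ (add_nonneg (hx _) (hreq _).1)) (M.mean_nonneg _)
    have : (0 : ℝ) ≤ if d j ∈ C then 1 else 0 := by split_ifs <;> norm_num
    linarith

/-- The states visited from `x₀` with bounded entries are finite in number. -/
theorem finite_visited_le (η : M.Control) {q : Fin n → ℝ} (hq : IsRequirement q)
    (x₀ : Fin n → ℝ) (B : ℝ) :
    {x ∈ Chain.visited (trans η q) x₀ | ∀ i, x i ≤ B}.Finite := by
  choose r hr using fun i => (hq i).2.2
  -- Steps are multiples of 1 / den. A coordinate stays in the translate of this lattice through its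
  -- initial value until it is first truncated to zero, and in the lattice itself from then on.
  set L : Fin n → Set ℝ := fun i =>
    {a | ∃ k : ℤ, a * (r i).den = k ∨ (a - x₀ i) * (r i).den = k} with hL
  have hstep : ∀ (x : Fin n → ℝ) (C : Finset (Fin n)), (∀ i, x i ∈ L i) →
      ∀ i, deficitStep q x C i ∈ L i := by
    intro x C hx i
    have hden : q i * (r i).den = (r i).num := by
      rw [← hr i]
      exact_mod_cast (r i).mul_den_eq_num
    rcases max_cases (x i + q i - if i ∈ C then 1 else 0) 0 with ⟨h, _⟩ | ⟨h, _⟩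
    · rw [deficitStep, h]
      obtain ⟨k, hk⟩ := hx i
      refine ⟨k + (r i).num - if i ∈ C then (r i).den else 0, ?_⟩
      push_cast
      rw [← hden]
      rcases hk with hk | hk
      · left
        rw [← hk]
        split_ifs <;> ring
      · right
        rw [← hk]
        split_ifs <;> ring
    · rw [deficitStep, h]
      exact ⟨0, by simp⟩
  have hmem : ∀ x ∈ Chain.visited (trans η q) x₀, ∀ i, x i ∈ L i := by
    intro x hx
    have hx' := Relation.TransGen.to_reflTransGen hx
    clear hx
    induction hx' with
    | refl => exact fun i => ⟨0, by simp⟩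
    | tail _ h ih =>
      obtain ⟨C, rfl⟩ := exists_of_canStep h
      exact hstep _ C ih
  have hfin : ∀ i, (L i ∩ Icc 0 B).Finite := by
    intro i
    have hd : (0 : ℝ) < (r i).den := by exact_mod_cast (r i).den_pos
    have hlat : ∀ c : ℝ, {a : ℝ | (∃ k : ℤ, (a - c) * (r i).den = k) ∧ a ∈ Icc 0 B}.Finite := by
      intro c
      refine ((Set.finite_Icc (⌈(0 - c) * (r i).den⌉) ⌊(B - c) * (r i).den⌋).image
        fun k : ℤ => (k : ℝ) / (r i).den + c).subset ?_
      rintro a ⟨⟨k, hk⟩, ha⟩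
      refine ⟨k, ⟨Int.ceil_le.2 ?_, Int.le_floor.2 ?_⟩, ?_⟩
      · rw [← hk]
        exact mul_le_mul_of_nonneg_right (by linarith [ha.1]) hd.le
      · rw [← hk]
        exact mul_le_mul_of_nonneg_right (by linarith [ha.2]) hd.le
      · change (k : ℝ) / (r i).den + c = a
        rw [← hk]
        field_simp
        ring
    refine ((hlat 0).union (hlat (x₀ i))).subset ?_
    rintro a ⟨⟨k, hk | hk⟩, ha⟩
    · exact Or.inl ⟨⟨k, by simpa using hk⟩, ha⟩
    · exact Or.inr ⟨⟨k, hk⟩, ha⟩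
  refine (Set.Finite.pi' hfin).subset ?_
  rintro x ⟨hx, hB⟩ i
  exact ⟨hmem x hx i, nonneg_of_visited hx i, hB i⟩

/-- A user without requirement never gains deficit beyond zero or its initial value. Negative drift
is thus needed only in the coordinates with q i ≠ 0. -/
theorem le_of_visited {η : M.Control} {q x₀ x : Fin n → ℝ}
    (h : x ∈ Chain.visited (trans η q) x₀) {i : Fin n} (hi : q i = 0) : x i ≤ max (x₀ i) 0 := by
  have h' := Relation.TransGen.to_reflTransGen h
  clear h
  induction h' with
  | refl => exact le_max_left _ _
  | tail _ h ih =>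
    obtain ⟨C, rfl⟩ := exists_of_canStep h
    refine max_le ?_ (le_max_right _ _)
    have : (0 : ℝ) ≤ if i ∈ C then 1 else 0 := by split_ifs <;> norm_num
    rw [hi]
    linarith

/-- The drift of a weighted sum of squared deficits. -/
theorem sum_law_mul_sq_le (R : M.Rule) {q : Fin n → ℝ} (hq : IsRequirement q) (x : Fin n → ℝ)
    {c : Fin n → ℝ} (hc : ∀ i, 0 ≤ c i) :
    ∑ C, R.law C * ∑ i, c i * deficitStep q x C i ^ 2 ≤
      ∑ i, c i * x i ^ 2 + 2 * ∑ i, c i * x i * (q i - R.prob i) + ∑ i, c i := by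
  have h1 : ∀ C : Finset (Fin n), ∑ i, c i * deficitStep q x C i ^ 2 ≤
      ∑ i, (c i * x i ^ 2 + 2 * (c i * x i * q i) + c i) -
        ∑ i, 2 * (c i * x i) * (if i ∈ C then 1 else 0) := by
    intro C
    rw [← Finset.sum_sub_distrib]
    refine Finset.sum_le_sum fun i _ => ?_
    have h2 : deficitStep q x C i ^ 2 ≤ (x i + q i - if i ∈ C then 1 else 0) ^ 2 := by
      unfold deficitStep
      rcases max_cases (x i + q i - if i ∈ C then 1 else 0) 0 with ⟨h, _⟩ | ⟨h, _⟩
      · rw [h]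
      · rw [h]
        nlinarith [sq_nonneg (x i + q i - if i ∈ C then 1 else 0)]
    have h3 := (hq i).1
    have h4 := (hq i).2.1
    -- The constant 1 bounds the square of q i minus the completion indicator, both in [0, 1].
    have h5 : (x i + q i - if i ∈ C then 1 else 0) ^ 2 ≤
        x i ^ 2 + 2 * (x i * q i) + 1 - 2 * x i * (if i ∈ C then 1 else 0) := by
      split_ifs <;> nlinarith
    calc _ ≤ c i * (x i ^ 2 + 2 * (x i * q i) + 1 - 2 * x i * (if i ∈ C then 1 else 0)) :=
          mul_le_mul_of_nonneg_left (h2.trans h5) (hc i)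
      _ = _ := by ring
  calc _ ≤ ∑ C, R.law C * (∑ i, (c i * x i ^ 2 + 2 * (c i * x i * q i) + c i) -
        ∑ i, 2 * (c i * x i) * (if i ∈ C then 1 else 0)) :=
        Finset.sum_le_sum fun C _ => mul_le_mul_of_nonneg_left (h1 C) (R.law_nonneg C)
    _ = ∑ i, (c i * x i ^ 2 + 2 * (c i * x i * q i) + c i) -
        ∑ i, 2 * (c i * x i) * R.prob i := by
      simp only [mul_sub, Finset.sum_sub_distrib, ← Finset.sum_mul, R.sum_law, one_mul]
      congr 1
      simp only [Finset.mul_sum]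
      rw [Finset.sum_comm]
      refine Finset.sum_congr rfl fun i _ => ?_
      rw [← R.sum_law_mul_ite, Finset.mul_sum]
      exact Finset.sum_congr rfl fun C _ => mul_left_comm _ _ _
    _ = _ := by
      simp only [mul_sub, Finset.mul_sum, Finset.sum_add_distrib, Finset.sum_sub_distrib,
        mul_assoc]
      ring

/-- A sufficient condition for feasibility: the drift of a weighted sum of squared deficits is
negative. -/
theorem mem_region_of_drift {η : M.Policy} (hη : η.InitAdmissible) {q : Fin n → ℝ}
    (hq : IsRequirement q) {c : Fin n → ℝ} (hc : ∀ i, 0 ≤ c i) {ε : ℝ} (hε : 0 < ε)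
    (hdrift : ∀ x : Fin n → ℝ, (∀ i, 0 ≤ x i) → ∀ i, q i ≠ 0 →
      ∑ i, c i * x i * (q i - (η.control q x).prob i) ≤ -(ε * x i))
    (hdrift' : ∀ x : Fin n → ℝ, (∀ i, 0 ≤ x i) →
      ∑ i, c i * x i * (q i - (η.control q x).prob i) ≤ 0) :
    q ∈ region η := by
  set p := trans η.control q with hp
  set v : (Fin n → ℝ) → ℝ := fun x => ∑ i, c i * x i ^ 2 with hv
  have hv0 : ∀ x, 0 ≤ v x := fun x => Finset.sum_nonneg fun i _ => mul_nonneg (hc i) (sq_nonneg _)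
  set b : ℝ := ∑ i, c i with hb
  have hb0 : 0 ≤ b := Finset.sum_nonneg fun i _ => hc i
  have hexp : ∀ x, ∑' z, p x z * ENNReal.ofReal (v z) =
      ENNReal.ofReal (∑ C, (η.control q x).law C * v (deficitStep q x C)) :=
    fun x => tsum_trans_mul_ofReal η.control q x fun C => hv0 _
  have hlyap : ∀ x₀ : Fin n → ℝ, ∃ C ⊆ Chain.visited p x₀, C.Finite ∧
      (∀ x ∈ C, ∑' z, p x z * ENNReal.ofReal (v z) ≤ ENNReal.ofReal (v x) + ENNReal.ofReal b) ∧
      (∀ x ∈ Chain.visited p x₀, x ∉ C →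
        1 + ∑' z, p x z * ENNReal.ofReal (v z) ≤ ENNReal.ofReal (v x)) := by
    intro x₀
    obtain ⟨B₀, hB₀⟩ := (Set.finite_range fun i => max (x₀ i) 0).bddAbove
    -- Above `B₀` only coordinates with q i ≠ 0 can lie. Once one of them exceeds (b + 1) / (2ε),
    -- twice the drift is below -(b + 1), which absorbs `b` and leaves -1.
    set B := max B₀ ((b + 1) / (2 * ε)) with hB
    refine ⟨{x ∈ Chain.visited p x₀ | ∀ i, x i ≤ B}, fun x hx => hx.1,
      finite_visited_le η.control hq x₀ B, ?_, ?_⟩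
    · rintro x ⟨hx, _⟩
      rw [hexp, ← ENNReal.ofReal_add (hv0 x) hb0]
      refine ENNReal.ofReal_le_ofReal ?_
      have h1 := sum_law_mul_sq_le (η.control q x) hq x hc
      have h2 := hdrift' x (nonneg_of_visited hx)
      simp only [hv]
      linarith
    · intro x hx hxC
      have hex : ∃ i, B < x i := by
        by_contra! hall
        exact hxC ⟨hx, hall⟩
      obtain ⟨i, hi⟩ := hex
      have hqi : q i ≠ 0 := by
        intro h0
        have h1 := le_of_visited hx h0
        have h2 := hB₀ ⟨i, rfl⟩
        have h3 := le_max_left B₀ ((b + 1) / (2 * ε))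
        simp only at h2
        linarith
      rw [hexp, ← ENNReal.ofReal_one, ← ENNReal.ofReal_add zero_le_one (Finset.sum_nonneg
        fun C _ => mul_nonneg (Rule.law_nonneg _ C) (hv0 _))]
      refine ENNReal.ofReal_le_ofReal ?_
      have h1 := sum_law_mul_sq_le (η.control q x) hq x hc
      have h2 := hdrift x (nonneg_of_visited hx) i hqi
      have h3 : (b + 1) / (2 * ε) < x i := (le_max_right _ _).trans_lt hi
      rw [div_lt_iff₀ (by positivity)] at h3
      simp only [hv]
      linarith
  have hirr : Chain.IrreducibleFrom p (η.init q) := by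
    refine hη q hq ?_
    -- Any start serves here: the drift from it yields some state with an irreducible chain, and
    -- admissibility passes this on to the prescribed one.
    obtain ⟨C, hCv, hCf, _, hout⟩ := hlyap 0
    obtain ⟨y, hy⟩ := (isClosedOn_univ η.control q).exists_canStep (mem_univ 0)
    exact Chain.exists_irreducibleFrom ((isClosedOn_univ η.control q).visited (mem_univ 0)) hCf hCv
      (fun z => ENNReal.ofReal_ne_top) hout ⟨y, Relation.TransGen.single hy⟩
  obtain ⟨C, hCv, hCf, hin, hout⟩ := hlyap (η.init q)
  exact ⟨hq, hirr, Chain.positiveRecurrentFrom_of_drift (isClosedOn_univ η.control q)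
    (mem_univ _) hirr hCf _ ENNReal.ofReal_ne_top (fun z => ENNReal.ofReal_ne_top) hCv hin hout⟩

/-! ### Efficiency of LDF+Greedy -/

/-- In terms of mean workloads weighted by the deficits, LDF+Greedy completes at least the
fraction `1 - b / δ` of any feasible requirement vector. -/
theorem mul_sum_le_sum_prob (hNBUE : ∀ i, IsNBUE (M.workload i)) {b : ℝ}
    (hb : ∀ i, M.mean i ≤ b) (hbδ : b ≤ M.δ) {q : Fin n → ℝ} (hq : q ∈ M.systemRegion)
    {D : PMF (Equiv.Perm (Fin n))} {x : Fin n → ℝ} (hx : ∀ i, 0 ≤ x i)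
    (hD : ∀ d ∈ D.support, Antitone (x ∘ d)) :
    (1 - b / M.δ) * ∑ i, M.mean i * x i * q i ≤
      ∑ i, M.mean i * x i * (M.greedyRule D).prob i := by
  obtain ⟨η, hη⟩ := mem_iUnion.1 hq
  refine (M.greedyRule D).le_sum_mul_prob Finset.univ (fun i => M.mean i * x i) id ?_
  have hsupp : ∀ᵐ d ∂(M.greedyRule D).seedLaw, Antitone (x ∘ (d : Equiv.Perm (Fin n))) := by
    let : MeasurableSpace (Equiv.Perm (Fin n)) := ⊤
    have h1 : ∀ᵐ d : Equiv.Perm (Fin n) ∂D.toMeasure, Antitone (x ∘ d) := by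
      rw [ae_iff, PMF.toMeasure_apply_eq_zero_iff _ MeasurableSpace.measurableSet_top]
      exact Set.disjoint_left.2 fun d hd hd' => hd' (hD d hd)
    exact h1
  refine hsupp.mono fun (d : Equiv.Perm (Fin n)) hd => ?_
  set P : Fin n → ℝ := fun i => (Measure.pi M.workload).real
    {w | w i ≤ coreTime (Greedy.proc M.m d w) i M.δ} with hP
  have hPd : ∀ i, (Measure.pi M.workload).real {w | i ∈ (M.greedyRule D).completed d w} =
      P i := by
    intro i
    have : {w | i ∈ (M.greedyRule D).completed d w} =
        {w | w i ≤ coreTime (Greedy.proc M.m d w) i M.δ} :=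
      Set.ext fun w => (M.greedyRule D).mem_completed (ω := d)
    rw [this]
  simp only [id, hPd]
  -- For each set of highest priorities, `meanStarted` links what greedy completes to what a
  -- feasible q requires. Non-negativity of 1 - b / δ is needed to scale the latter.
  have key := sum_mul_nonneg_of_antitone hd (fun j => hx (d j))
    (a := fun j => M.mean (d j) * P (d j) - (1 - b / M.δ) * (M.mean (d j) * q (d j))) (by
      intro J hJ
      rw [Finset.sum_sub_distrib, ← Finset.mul_sum, sub_nonneg]
      refine le_trans ?_ (M.mul_meanStarted_le hb d hJ)
      refine mul_le_mul_of_nonneg_left (sum_mean_mul_le_meanStarted hNBUE hη d hJ) ?_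
      rw [sub_nonneg, div_le_one M.δ_pos]
      exact hbδ)
  have h2 := Equiv.sum_comp d fun i =>
    x i * (M.mean i * P i - (1 - b / M.δ) * (M.mean i * q i))
  simp only [Function.comp_apply] at key
  rw [h2] at key
  have h3 : ∑ i, x i * (M.mean i * P i - (1 - b / M.δ) * (M.mean i * q i)) =
      ∑ i, M.mean i * x i * P i - (1 - b / M.δ) * ∑ i, M.mean i * x i * q i := by
    rw [Finset.mul_sum, ← Finset.sum_sub_distrib]
    exact Finset.sum_congr rfl fun i _ => by ring
  rw [h3] at key
  linarith

theorem IsRequirement.smul {q : Fin n → ℝ} (hq : IsRequirement q) {γ : ℚ} (h0 : 0 ≤ γ)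
    (h1 : γ ≤ 1) : IsRequirement ((γ : ℝ) • q) := by
  intro i
  obtain ⟨hq0, hq1, r, hr⟩ := hq i
  have h0' : (0 : ℝ) ≤ γ := by exact_mod_cast h0
  have h1' : (γ : ℝ) ≤ 1 := by exact_mod_cast h1
  refine ⟨mul_nonneg h0' hq0, mul_le_one₀ h1' hq0 hq1, γ * r, ?_⟩
  simp [← hr]

theorem zero_smul_mem_region (τ : LDFTieBreak n) (init : (Fin n → ℝ) → (Fin n → ℝ))
    (hinit : (M.ldfGreedy τ init).InitAdmissible) (q : Fin n → ℝ) :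
    (0 : ℝ) • q ∈ region (M.ldfGreedy τ init) := by
  rw [zero_smul]
  refine mem_region_of_drift hinit (fun i => ⟨le_rfl, zero_le_one, 0, by simp⟩)
    (c := fun _ => 0) (fun _ => le_rfl) one_pos ?_ ?_
  · intro x _ i hi
    exact absurd rfl hi
  · simp

theorem smul_mem_region [NeZero n] (hNBUE : ∀ i, IsNBUE (M.workload i)) (τ : LDFTieBreak n)
    (init : (Fin n → ℝ) → (Fin n → ℝ)) (hinit : (M.ldfGreedy τ init).InitAdmissible) {b : ℝ}
    (hb : ∀ i, M.mean i ≤ b) {γ : ℚ} (h0 : 0 ≤ γ) (hγ : (γ : ℝ) < 1 - b / M.δ) {q : Fin n → ℝ}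
    (hq : q ∈ M.systemRegion) : (γ : ℝ) • q ∈ region (M.ldfGreedy τ init) := by
  have hb0 : 0 ≤ b := (M.mean_nonneg 0).trans (hb 0)
  have h0' : (0 : ℝ) ≤ γ := by exact_mod_cast h0
  have hbδ : b ≤ M.δ := by
    rw [← div_le_one M.δ_pos]
    linarith
  have hlt1 : (γ : ℝ) < 1 := by
    have := div_nonneg hb0 M.δ_pos.le
    linarith
  have hreq : IsRequirement q := by
    obtain ⟨η, hη⟩ := mem_iUnion.1 hq
    exact hη.1
  -- Users of mean zero are invisible to the bound weighted by means. Their tasks are almost surely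
  -- completed, so weight 1 gives them the drift γ q i - 1 ≤ -(1 - γ), times the deficit.
  set c : Fin n → ℝ := fun i => if M.mean i = 0 then 1 else M.mean i with hc
  set e : Fin n → ℝ := fun i =>
    if M.mean i = 0 then 1 - γ else (1 - b / M.δ - γ) * (M.mean i * q i) with he
  have he0 : ∀ i, 0 ≤ e i := by
    intro i
    simp only [he]
    split_ifs
    · linarith
    · exact mul_nonneg (by linarith) (mul_nonneg (M.mean_nonneg i) (hreq i).1)
  have hdrift : ∀ x : Fin n → ℝ, (∀ i, 0 ≤ x i) →
      ∑ i, c i * x i * (((γ : ℝ) • q) i -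
        ((M.ldfGreedy τ init).control ((γ : ℝ) • q) x).prob i) ≤ -∑ i, e i * x i := by
    intro x hx
    set R := M.greedyRule (τ.decision ((γ : ℝ) • q) x) with hR
    have hmain := mul_sum_le_sum_prob hNBUE hb hbδ hq hx (τ.sorted ((γ : ℝ) • q) x)
    change ∑ i, c i * x i * ((γ : ℝ) * q i - R.prob i) ≤ _
    have h1 : ∀ i, c i * x i * ((γ : ℝ) * q i - R.prob i) ≤ -(e i * x i) +
        ((1 - b / M.δ) * (M.mean i * x i * q i) - M.mean i * x i * R.prob i) := by
      intro i
      simp only [hc, he]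
      split_ifs with hi
      · rw [R.prob_eq_one_of_mean_eq_zero hi, hi]
        have : (γ : ℝ) * q i ≤ γ := mul_le_of_le_one_right h0' (hreq i).2.1
        nlinarith [hx i]
      · refine le_of_eq ?_
        ring
    refine (Finset.sum_le_sum fun i _ => h1 i).trans ?_
    rw [Finset.sum_add_distrib, Finset.sum_neg_distrib, Finset.sum_sub_distrib, ← Finset.mul_sum]
    linarith
  obtain ⟨i₀, _, hi₀⟩ := Finset.exists_min_image Finset.univ
    (fun i => if (γ : ℝ) * q i = 0 then 1 else e i) ⟨0, Finset.mem_univ _⟩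
  have hε : (0 : ℝ) < if (γ : ℝ) * q i₀ = 0 then 1 else e i₀ := by
    split_ifs with h
    · exact one_pos
    · simp only [he]
      have hq0 : 0 < q i₀ := lt_of_le_of_ne (hreq i₀).1 fun h' => h (by rw [← h', mul_zero])
      split_ifs with hm
      · linarith
      · exact mul_pos (by linarith) (mul_pos (lt_of_le_of_ne (M.mean_nonneg i₀) (Ne.symm hm)) hq0)
  refine mem_region_of_drift hinit (hreq.smul h0 (by exact_mod_cast hlt1.le)) (c := c)
    (fun i => ?_) hε (fun x hx i hi => (hdrift x hx).trans (neg_le_neg ?_)) fun x hx =>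
      (hdrift x hx).trans (neg_nonpos.2 (Finset.sum_nonneg fun i _ => mul_nonneg (he0 i) (hx i)))
  · simp only [hc]
    split_ifs
    · exact zero_le_one
    · exact M.mean_nonneg i
  · have h1 := hi₀ i (Finset.mem_univ i)
    have hi' : (γ : ℝ) * q i ≠ 0 := hi
    rw [if_neg hi'] at h1
    calc _ ≤ e i * x i := mul_le_mul_of_nonneg_right h1 (hx i)
      _ ≤ _ := Finset.single_le_sum (f := fun i => e i * x i)
        (fun i _ => mul_nonneg (he0 i) (hx i)) (Finset.mem_univ i)

end SRTMIC

end

theorem theorem3 {n : ℕ} [NeZero n] (M : SRTMIC n)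
    (hNBUE : ∀ i, IsNBUE (M.workload i))
    (τ : SRTMIC.LDFTieBreak n) (init : (Fin n → ℝ) → (Fin n → ℝ))
    (hinit : (M.ldfGreedy τ init).InitAdmissible) :
    ((1 - (⨆ i, M.mean i) / M.δ : ℝ) : EReal) ≤
      SRTMIC.efficiencyRatio (M.ldfGreedy τ init) := by
  -- The factor 0 is always admissible. This settles a non-positive bound and makes the rational γ
  -- below non-negative.
  have h0 : (0 : EReal) ≤ SRTMIC.efficiencyRatio (M.ldfGreedy τ init) :=
    le_sSup ⟨0, by simp, fun q _ => SRTMIC.zero_smul_mem_region τ init hinit q⟩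
  by_contra! hlt
  -- γ is taken rational so that γq is again a requirement vector.
  obtain ⟨γ, h1, h2⟩ := EReal.lt_iff_exists_rat_btwn.1 hlt
  have hγ0 : 0 ≤ γ := by
    have h3 := h0.trans h1.le
    exact_mod_cast h3
  have hγ1 : (γ : ℝ) < 1 - (⨆ i, M.mean i) / M.δ := by exact_mod_cast h2
  exact absurd h1 (not_lt.2 (le_sSup ⟨γ, by norm_cast, fun q hq =>
    SRTMIC.smul_mem_region hNBUE τ init hinit
      (fun i => le_ciSup (Set.finite_range M.mean).bddAbove i) hγ0 hγ1 hq⟩))
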